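/- For $d\ge 1$ and $\psi:\mathbb N=\{1,2,\dots\}\to[0,\infty)$ let $\mathcal W_d(\psi)$ be the set of $\boldsymbol x\in\mathbb R^d$ such that $\|q\boldsymbol x-\boldsymbol p\|_\infty<\psi(q)$ for infinitely many $(\boldsymbol p,q)\in\mathbb Z^d\times\mathbb N$. Write $\mathcal W_1(\sigma)=\mathcal W_1(q\mapsto q^{-\sigma})$ for $\sigma>0$. The Diophantine type of $x\in\mathbb R$ is $\sup\{\tau>0: x\in\mathcal W_1(\tau)\}\in[1,\infty]$. For irrational $x=[a_0;a_1,a_2,\dots]$ let $q_k$ be the continuants (the denominators of the convergents, $q_0=1$, $q_{-1}=0$). For a real number $R\ge1$ let $k_0=-1$ and let $k_1<k_2<\cdots$ be the indices $k\ge0$ with $a_{k+1}>R$. Put $B_{m}=[\,q_{k_{m-1}+1}-Rq_{k_{m-1}},\,q_{k_{m}}]\cap\mathbb N$ for $m\ge1$, let $\Sigma_{B_m}$ be the sum of the elements of $B_m$, and let $\lambda_m=\min B_m$. We say that $x$ has the positive density property if for some $R\ge1$ $$\limsup_{m\to\infty}\frac{\lambda_m}{\Sigma_{B_1}+\dots+\Sigma_{B_{m-1}}+\lambda_m}<1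 ,$$ where the condition is regarded as satisfied if only finitely many partial quotients of $x$ exceed $R$. Theorem. Let $d\ge3$ and let $\psi:\mathbb N\to[0,\infty)$ be non-increasing with $\sum_{q\in\mathbb N}\psi(q)^d=\infty$. Then, with respect to $(d-1)$-dimensional Lebesgue measure, almost every point of the fiber $\{x\}\times\mathbb R^{d-1}$ belongs to $\mathcal W_d(\psi)$ for: (a) every $x\in\mathbb Q$ (and this also holds for $d=2$); (b) every $x\in\mathbb R\setminus\mathbb Q$ with the positive density property. The numbers with this property include every $x\notin\mathcal W_1(\varphi)$, where $\varphi=\frac{1+\sqrt5}2$, and every $x\notin\mathcal W_1(2)$ for which there is $R\ge1$ such that $q_{k_{m}}\ge 2q_{k_{m-1}+1}$ for all but finitely many $m$ (for which $k_m$ exists); there are also numbers with the positive density property that are in neither of these two classes; (c) for each $\sigma\in[1,\infty]$, uncountably many $x$ of Diophantine type $\sigma$ (these $x$ may depend on $\psi$). -/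

import Mathlib

open scoped ENNReal

/-- An approximating function: a non-negative non-increasing function on the positive integers
(the value at `0` plays no role). -/
structure IsApproximatingFunction (ψ : ℕ → ℝ) : Prop where
  nonneg : ∀ q : ℕ, 1 ≤ q → 0 ≤ ψ q
  antitone : ∀ q r : ℕ, 1 ≤ q → q ≤ r → ψ r ≤ ψ q

/-- `𝒲_d(ψ)`: the vectors `x ∈ ℝ^d` such that `‖q x - p‖_∞ < ψ q` for infinitely many
`(p, q) ∈ ℤ^d × ℕ`, `q ≥ 1`. The norm on `Fin d → ℝ` is the sup norm. -/
def approximable (d : ℕ) (ψ : ℕ → ℝ) : Set (Fin d → ℝ) :=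
  {x | {pq : (Fin d → ℤ) × ℕ |
    1 ≤ pq.2 ∧ ‖fun i => (pq.2 : ℝ) * x i - (pq.1 i : ℝ)‖ < ψ pq.2}.Infinite}

/-- `𝒲_1(σ) = 𝒲_1(q ↦ q^{-σ})`, as a set of real numbers. -/
def approximableOne (σ : ℝ) : Set ℝ :=
  {x | (fun _ => x) ∈ approximable 1 (fun q => (q : ℝ) ^ (-σ))}

/-- The Diophantine type of a real number: the supremum of the `τ > 0` with `x ∈ 𝒲_1(τ)`. -/
noncomputable def diophantineType (x : ℝ) : ℝ≥0∞ :=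
  ⨆ τ ∈ {τ : ℝ | 0 < τ ∧ x ∈ approximableOne τ}, ENNReal.ofReal τ

/-- Lebesgue-almost every point of the fiber `{x} × ℝ^n ⊆ ℝ^(n+1)` is `ψ`-approximable. -/
def FullFiber (n : ℕ) (ψ : ℕ → ℝ) (x : ℝ) : Prop :=
  ∀ᵐ y : Fin n → ℝ ∂MeasureTheory.volume, (Fin.cons x y : Fin (n + 1) → ℝ) ∈ approximable (n + 1) ψ

/-- The partial quotients `a_0, a_1, a_2, …` of the simple continued fraction of `x`
(with the value `0` after termination, which does not happen for irrational `x`). -/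
noncomputable def partialQuotient (x : ℝ) : ℕ → ℝ
  | 0 => (GenContFract.of x).h
  | k + 1 => ((GenContFract.of x).partDens.get? k).getD 0

/-- The continuants `q_0 = 1, q_1 = a_1, q_2, …`: the denominators of the convergents of `x`. -/
noncomputable def continuant (x : ℝ) (k : ℕ) : ℝ :=
  (GenContFract.of x).dens k

/-- The indices `k ≥ 0` with `a_{k+1} > R`. -/
def largeIndices (x R : ℝ) : Set ℕ :=
  {k | R < partialQuotient x (k + 1)}

/-- With `k_0 = -1` and `k_1 < k_2 < …` the elements of `largeIndices x R`, this is `k_{m+1}`. -/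
noncomputable def largeIndex (x R : ℝ) (m : ℕ) : ℕ :=
  Nat.nth (fun k => k ∈ largeIndices x R) m

/-- The least element of the block `B_{m+1} = [q_{k_m + 1} - R q_{k_m}, q_{k_{m+1}}] ∩ ℕ`.
For `m = 0` one has `k_0 = -1`, `q_0 = 1`, `q_{-1} = 0`. -/
noncomputable def blockMin (x R : ℝ) : ℕ → ℕ
  | 0 => 1
  | m + 1 => ⌈continuant x (largeIndex x R m + 1) - R * continuant x (largeIndex x R m)⌉₊

/-- The block `B_{m+1} = [q_{k_m + 1} - R q_{k_m}, q_{k_{m+1}}] ∩ ℕ`. -/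
noncomputable def block (x R : ℝ) (m : ℕ) : Finset ℕ :=
  Finset.Icc (blockMin x R m) ⌊continuant x (largeIndex x R m)⌋₊

/-- Let `L_1, L_2, …` be the concatenation of the blocks `B_1, B_2, …`, each in increasing order.
This is the partial sum `L_1 + L_2 + … + L_α` where `α` is the position of the least element of
`B_{m+1}`. -/
noncomputable def sumToBlockMin (x R : ℝ) (m : ℕ) : ℕ :=
  (∑ j ∈ Finset.range m, ∑ L ∈ block x R j, L) + blockMin x R m

/-- The positive density property: `x` is irrational and for some `R ≥ 1` the ratios of the least
element of a block to the sum of all block elements up to it have limsup less than `1`. If only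
finitely many partial quotients exceed `R` there are finitely many blocks, the last one being
infinite, and the condition is void. -/
def PositiveDensityProperty (x : ℝ) : Prop :=
  Irrational x ∧ ∃ R : ℝ, 1 ≤ R ∧ ((largeIndices x R).Finite ∨
    Filter.limsup (fun m => (blockMin x R m : ℝ) / (sumToBlockMin x R m : ℝ)) Filter.atTop < 1)

/-- There is `R ≥ 1` such that, for all but finitely many `i` with `a_{i+1} > R`, if `j > i` is the
next index with `a_{j+1} > R` then `q_j ≥ 2 q_{i+1}`. -/
def ContinuantsDouble (x : ℝ) : Prop :=
  ∃ R : ℝ, 1 ≤ R ∧ ∃ N : ℕ, ∀ i j : ℕ, N ≤ i → i < j →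
    i ∈ largeIndices x R → j ∈ largeIndices x R →
    (∀ l, i < l → l < j → l ∉ largeIndices x R) →
    2 * continuant x (i + 1) ≤ continuant x j

/-! The core is a ubiquity argument inside the fiber. At scale `N = 2^k`, with `φ` a truncation of
`ψ(N)`, Dirichlet's theorem gives every `y` some `q ≤ N` with `‖qx‖ < φ` and `‖q y_i‖ < 1/t`, where
`t^n ≍ Nφ`. Suppose `x` has a coprime approximation `a/b` of convergent quality with `1/φ ≤ b ≤ εN`.
Then the multiples of `x` are spread evenly enough that only `O(εNφ)` of the `q ≤ εN` satisfy `‖qx‖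
< φ` (`card_filter_approx_le`), and these serve at most half of any ball
(`volumeReal_biUnion_approx_le`). The rest is served by points `p/q` with `q ≍ N`, from which a
Vitali covering extracts many separated centres (`exists_separated_centers`). Balls of radius `φ/N`
about the centres consist of approximable points; their total volume at scale `k` is `≍ 2^k φ^(n+1)`
and they are quasi-independent across scales. The second moment method therefore fills a fixed
proportion of every ball (`volumeReal_biUnion_ball_ge`), and Lebesgue density finishes
(`fullFiber_of_scales`).

Scales with `φ < 2^(-2k/5)` contribute a convergent series once `n + 1 ≥ 3` (`exists_truncation`).
On the others `1/φ` is far below `2^(k/2)`, so it is enough that `b ≤ ε 2^k ≤ C b²`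
(`fullFiber_of_sq_ge`). Continuants supply such `b` at all large scales when `q_{k+1} = O(q_k²)`.
Positive density forces this growth: the blocks ending at or before `q_k` sum to `O(q_k²)`, while
the next block starts near `q_{k+1}`.

For a prescribed type, large partial quotients are inserted at thresholds so sparse that the series
still diverges over the scales in between, where continuants grow at most threefold; free binary
choices in the partial quotients make the family uncountable. Over a rational point, multiples of
its denominator annihilate the first coordinate and Dirichlet's theorem handles the others. -/

/-! ### Second moments, packing and Lebesgue density -/

-- Cauchy–Schwarz applied to the counting function `∑ 1_{E i}`, which is supported on the union; it
-- is obtained here as a discriminant inequality for `c ↦ ∫ (∑ 1_{E i} - c 1_U)²`.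
open MeasureTheory Metric in
theorem sq_sum_measureReal_le {α ι : Type*} [MeasurableSpace α] (μ : Measure α) (s : Finset ι)
    (E : ι → Set α) (hE : ∀ i ∈ s, MeasurableSet (E i)) (hfin : ∀ i ∈ s, μ (E i) ≠ ∞) :
    (∑ i ∈ s, μ.real (E i)) ^ 2 ≤
      μ.real (⋃ i ∈ s, E i) * ∑ i ∈ s, ∑ j ∈ s, μ.real (E i ∩ E j) := by
  set U := ⋃ i ∈ s, E i with hU
  have hUm : MeasurableSet U := s.measurableSet_biUnion hE
  have hUfin : μ U ≠ ∞ := (measure_biUnion_lt_top s.finite_toSet fun i hi => (hfin i hi).lt_top).ne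
  have key : ∀ c : ℝ, 0 ≤ μ.real U * (c * c) + (-2 * ∑ i ∈ s, μ.real (E i)) * c +
      ∑ i ∈ s, ∑ j ∈ s, μ.real (E i ∩ E j) := by
    intro c
    have hsq : ∀ y, (∑ i ∈ s, (E i).indicator (fun _ => (1 : ℝ)) y -
        c * U.indicator (fun _ => (1 : ℝ)) y) ^ 2 =
        (∑ i ∈ s, ∑ j ∈ s, (E i ∩ E j).indicator (fun _ => (1 : ℝ)) y) -
          2 * c * (∑ i ∈ s, (E i).indicator (fun _ => (1 : ℝ)) y) +
          c ^ 2 * U.indicator (fun _ => (1 : ℝ)) y := by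
      intro y
      have h1 : (∑ i ∈ s, ∑ j ∈ s, (E i ∩ E j).indicator (fun _ => (1 : ℝ)) y) =
          (∑ i ∈ s, (E i).indicator (fun _ => (1 : ℝ)) y) ^ 2 := by
        rw [sq, Finset.sum_mul_sum]
        refine Finset.sum_congr rfl fun i _ => Finset.sum_congr rfl fun j _ => ?_
        by_cases hi : y ∈ E i <;> by_cases hj : y ∈ E j <;> simp [hi, hj]
      rw [h1]
      by_cases hy : y ∈ U
      · simp only [hy, Set.indicator_of_mem]; ring
      · have : ∀ i ∈ s, (E i).indicator (fun _ => (1 : ℝ)) y = 0 := by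
          intro i hi
          refine Set.indicator_of_notMem (fun h => hy ?_) _
          exact Set.mem_biUnion hi h
        simp [hy, Finset.sum_eq_zero this]
    have hindicator : ∀ {A : Set α}, MeasurableSet A → μ A ≠ ∞ →
        Integrable (A.indicator fun _ => (1 : ℝ)) μ := fun hA hA' =>
      (integrable_indicator_iff hA).2 (integrableOn_const hA')
    have hintg : ∀ {A : Set α}, MeasurableSet A →
        ∫ y, A.indicator (fun _ => (1 : ℝ)) y ∂μ = μ.real A := fun hA => by
      rw [integral_indicator hA]; simp
    have hm2 : ∀ i ∈ s, ∀ j ∈ s, Integrable ((E i ∩ E j).indicator fun _ => (1 : ℝ)) μ :=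
      fun i hi j hj => hindicator ((hE i hi).inter (hE j hj))
        (measure_ne_top_of_subset Set.inter_subset_left (hfin i hi))
    have h0 : 0 ≤ ∫ y, (∑ i ∈ s, (E i).indicator (fun _ => (1 : ℝ)) y -
        c * U.indicator (fun _ => (1 : ℝ)) y) ^ 2 ∂μ := integral_nonneg fun y => sq_nonneg _
    simp_rw [hsq] at h0
    rw [integral_add, integral_sub, integral_const_mul, integral_const_mul, integral_finsetSum,
      integral_finsetSum, hintg hUm, Finset.sum_congr rfl fun i hi => hintg (hE i hi),
      Finset.sum_congr rfl fun i hi => by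
        rw [integral_finsetSum _ fun j hj => hm2 i hi j hj,
          Finset.sum_congr rfl fun j hj => hintg ((hE i hi).inter (hE j hj))]] at h0
    · linarith
    · exact fun i hi => hindicator (hE i hi) (hfin i hi)
    · exact fun i hi => integrable_finsetSum _ fun j hj => hm2 i hi j hj
    · exact integrable_finsetSum _ fun i hi => integrable_finsetSum _ fun j hj => hm2 i hi j hj
    · exact (integrable_finsetSum _ fun i hi => hindicator (hE i hi) (hfin i hi)).const_mul _
    · exact (integrable_finsetSum _ fun i hi => integrable_finsetSum _ fun j hj =>
        hm2 i hi j hj).sub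
          ((integrable_finsetSum _ fun i hi => hindicator (hE i hi) (hfin i hi)).const_mul _)
    · exact (hindicator hUm hUfin).const_mul _
  have := discrim_le_zero key
  rw [discrim] at this
  nlinarith

theorem volumeReal_pi_ball {n : ℕ} (a : Fin n → ℝ) {r : ℝ} (hr : 0 < r) :
    MeasureTheory.volume.real (Metric.ball a r) = (2 * r) ^ n := by
  rw [MeasureTheory.measureReal_def, Real.volume_pi_ball a hr, Fintype.card_fin,
    ENNReal.toReal_ofReal (by positivity)]

theorem volumeReal_pi_closedBall {n : ℕ} (a : Fin n → ℝ) {r : ℝ} (hr : 0 ≤ r) :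
    MeasureTheory.volume.real (Metric.closedBall a r) = (2 * r) ^ n := by
  rw [MeasureTheory.measureReal_def, Real.volume_pi_closedBall a hr, Fintype.card_fin,
    ENNReal.toReal_ofReal (by positivity)]

open MeasureTheory Metric in
theorem card_mul_pow_le_of_disjoint_closedBall {n : ℕ} (S : Finset (Fin n → ℝ)) {ρ R : ℝ}
    (hρ : 0 < ρ) (hR : 0 ≤ R) (w : Fin n → ℝ)
    (hdisj : (S : Set (Fin n → ℝ)).PairwiseDisjoint fun s => closedBall s ρ)
    (hS : ∀ s ∈ S, s ∈ closedBall w R) : (S.card : ℝ) * ρ ^ n ≤ (R + ρ) ^ n := by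
  have h1 : volume.real (⋃ s ∈ S, closedBall s ρ) = S.card * (2 * ρ) ^ n := by
    rw [measureReal_biUnion_finset hdisj (fun s _ => isClosed_closedBall.measurableSet)
      fun s _ => measure_closedBall_lt_top.ne]
    simp [volumeReal_pi_closedBall _ hρ.le]
  have h2 : volume.real (⋃ s ∈ S, closedBall s ρ) ≤ volume.real (closedBall w (R + ρ)) := by
    refine measureReal_mono ?_ measure_closedBall_lt_top.ne
    refine Set.iUnion₂_subset fun s hs => closedBall_subset_closedBall' ?_
    have := mem_closedBall.1 (hS s hs)
    linarith
  rw [h1, volumeReal_pi_closedBall _ (by positivity), mul_pow, mul_pow] at h2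
  have : (0 : ℝ) < 2 ^ n := by positivity
  nlinarith

-- Only centres `s'` within `δ + δ' ≤ 2δ` of `s` matter, and packing allows at most `(2δ/ρ' + 1)^n`
-- of them. The `1` in this count produces the error term with `e`; for two scales `j ≤ k` it will
-- be `2^(j-k)`, so the errors sum geometrically.
open MeasureTheory Metric in
theorem sum_volumeReal_inter_le {n : ℕ} (hn : 1 ≤ n) {r : ℝ} (z : Fin n → ℝ)
    (S S' : Finset (Fin n → ℝ)) {ρ ρ' δ δ' e : ℝ} (hr : 0 < r)
    (hρ : 0 < ρ) (hρ' : 0 < ρ') (hρr : ρ ≤ r) (hδ : 0 < δ) (hδ' : 0 < δ')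
    (he : 0 ≤ e) (he1 : e ≤ 1) (hδe : δ' ≤ e * δ)
    (hdisj : (S : Set (Fin n → ℝ)).PairwiseDisjoint fun s => closedBall s ρ)
    (hdisj' : (S' : Set (Fin n → ℝ)).PairwiseDisjoint fun s => closedBall s ρ')
    (hS : ∀ s ∈ S, s ∈ closedBall z r) :
    ∑ s ∈ S, ∑ s' ∈ S', volume.real (ball s δ ∩ ball s' δ') ≤
      16 ^ n * r ^ n * ((δ / ρ) ^ n * (δ' / ρ') ^ n + e * (δ / ρ) ^ n) := by
  classical
  have hδδ : δ' ≤ δ := hδe.trans (by nlinarith)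
  have hinner : ∀ s ∈ S, ∑ s' ∈ S', volume.real (ball s δ ∩ ball s' δ') ≤
      2 ^ n * ((2 * δ / ρ') ^ n + 1) * (2 * δ') ^ n := by
    intro s _
    have hcard := card_mul_pow_le_of_disjoint_closedBall (S'.filter (· ∈ closedBall s (2 * δ)))
      hρ' (by positivity : 0 ≤ 2 * δ) s (hdisj'.subset (by exact_mod_cast Finset.filter_subset _ _))
      (by simp)
    have hcard' : ((S'.filter (· ∈ closedBall s (2 * δ))).card : ℝ) ≤
        2 ^ n * ((2 * δ / ρ') ^ n + 1) := by
      have h1 : ((2 * δ + ρ') / ρ') ^ n ≤ 2 ^ (n - 1) * ((2 * δ / ρ') ^ n + 1 ^ n) := by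
        rw [add_div, div_self hρ'.ne']
        exact add_pow_le (by positivity) zero_le_one n
      have h2 : (2 : ℝ) ^ (n - 1) ≤ 2 ^ n := pow_le_pow_right₀ one_le_two (Nat.sub_le n 1)
      rw [← le_div_iff₀ (by positivity), ← div_pow] at hcard
      rw [one_pow] at h1
      exact hcard.trans (h1.trans (by gcongr))
    calc ∑ s' ∈ S', volume.real (ball s δ ∩ ball s' δ')
        ≤ ∑ s' ∈ S'.filter (· ∈ closedBall s (2 * δ)), (2 * δ') ^ n := by
          rw [Finset.sum_filter]
          refine Finset.sum_le_sum fun s' _ => ?_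
          split_ifs with h
          · rw [← volumeReal_pi_ball s' hδ']
            exact measureReal_mono Set.inter_subset_right measure_ball_lt_top.ne
          · have : ball s δ ∩ ball s' δ' = ∅ := by
              refine Set.disjoint_iff_inter_eq_empty.1 (ball_disjoint_ball ?_)
              rw [mem_closedBall, not_le, dist_comm] at h
              linarith
            simp [this]
      _ ≤ _ := by
          rw [Finset.sum_const, nsmul_eq_mul]
          gcongr
  have hcardS : (S.card : ℝ) ≤ (2 * r / ρ) ^ n := by
    have h1 := card_mul_pow_le_of_disjoint_closedBall S hρ hr.le z hdisj hS
    rw [← le_div_iff₀ (by positivity), ← div_pow] at h1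
    refine h1.trans ?_
    gcongr
    linarith
  have hepow : e ^ n ≤ e := pow_le_of_le_one he he1 (by omega)
  have hδpow : δ' ^ n ≤ e * δ ^ n := calc
    δ' ^ n ≤ (e * δ) ^ n := by gcongr
    _ = e ^ n * δ ^ n := mul_pow _ _ _
    _ ≤ _ := by gcongr
  have h8 : (8 : ℝ) ^ n ≤ 16 ^ n := by gcongr; norm_num
  calc ∑ s ∈ S, ∑ s' ∈ S', volume.real (ball s δ ∩ ball s' δ')
      ≤ S.card * (2 ^ n * ((2 * δ / ρ') ^ n + 1) * (2 * δ') ^ n) := by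
        rw [← nsmul_eq_mul]
        exact Finset.sum_le_card_nsmul _ _ _ hinner
    _ ≤ (2 * r / ρ) ^ n * (2 ^ n * ((2 * δ / ρ') ^ n + 1) * (2 * δ') ^ n) := by gcongr
    _ = 16 ^ n * r ^ n * ((δ / ρ) ^ n * (δ' / ρ') ^ n) + 8 ^ n * r ^ n * (δ' ^ n / ρ ^ n) := by
        rw [show (16 : ℝ) ^ n = 2 ^ n * 2 ^ n * 2 ^ n * 2 ^ n by simp only [← mul_pow]; norm_num,
          show (8 : ℝ) ^ n = 2 ^ n * 2 ^ n * 2 ^ n by simp only [← mul_pow]; norm_num]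
        simp only [div_pow, mul_pow]
        field_simp
    _ ≤ 16 ^ n * r ^ n * ((δ / ρ) ^ n * (δ' / ρ') ^ n) +
        16 ^ n * r ^ n * (e * δ ^ n / ρ ^ n) := by gcongr
    _ = _ := by rw [div_pow δ ρ]; ring

theorem sum_half_pow_sub_le (J : Finset ℕ) (j : ℕ) :
    ∑ k ∈ J, (if j ≤ k then (1 / 2 : ℝ) ^ (k - j) else 0) ≤ 2 := by
  rw [← Finset.sum_filter]
  have hinj : Set.InjOn (fun k => k - j) (J.filter (j ≤ ·) : Set ℕ) := by
    intro a ha b hb hab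
    have ha := (Finset.mem_filter.1 (Finset.mem_coe.1 ha)).2
    have hb := (Finset.mem_filter.1 (Finset.mem_coe.1 hb)).2
    dsimp only at hab
    omega
  rw [← Finset.sum_image (f := fun i => (1 / 2 : ℝ) ^ i) hinj]
  refine le_trans ?_ tsum_geometric_two.le
  exact summable_geometric_two.sum_le_tsum _ fun i _ => by positivity

open MeasureTheory Metric in
/-- A union of small balls, centred at well separated points that are plentiful at every scale,
occupies a positive proportion of the ambient ball. -/
theorem volumeReal_biUnion_ball_ge {n : ℕ} (hn : 1 ≤ n) {r c : ℝ} (hr : 0 < r) (hc : 0 < c)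
    (z : Fin n → ℝ) (J : Finset ℕ) (S : ℕ → Finset (Fin n → ℝ)) (ρ δ : ℕ → ℝ)
    (hρ : ∀ j ∈ J, 0 < ρ j) (hρr : ∀ j ∈ J, ρ j ≤ r) (hδ : ∀ j ∈ J, 0 < δ j)
    (hdecay : ∀ j ∈ J, ∀ k ∈ J, j ≤ k → δ k ≤ (1 / 2) ^ (k - j) * δ j)
    (hdisj : ∀ j ∈ J, (S j : Set (Fin n → ℝ)).PairwiseDisjoint fun s => closedBall s (ρ j))
    (hS : ∀ j ∈ J, ∀ s ∈ S j, s ∈ closedBall z r)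
    (hcard : ∀ j ∈ J, c * (r / ρ j) ^ n ≤ (S j).card)
    (hsum : 1 ≤ ∑ j ∈ J, (δ j / ρ j) ^ n) :
    c ^ 2 / (5 * 4 ^ n) * r ^ n ≤ volume.real (⋃ j ∈ J, ⋃ s ∈ S j, ball s (δ j)) := by
  set a : ℕ → ℝ := fun j => (δ j / ρ j) ^ n with ha
  have ha0 : ∀ j ∈ J, 0 ≤ a j := fun j hj => by
    have := hρ j hj; have := hδ j hj; simp only [ha]; positivity
  -- The geometric error weight, set to zero for `k < j` so that the sum over all ordered pairs can
  -- use both `h j k` and `h k j`.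
  set h : ℕ → ℕ → ℝ := fun j k => if j ≤ k then (1 / 2 : ℝ) ^ (k - j) else 0 with hh
  have hh0 : ∀ j k, 0 ≤ h j k := fun j k => by simp only [hh]; split_ifs <;> positivity
  set I := J.sigma S with hI
  have hmem : ∀ i ∈ I, i.1 ∈ J ∧ i.2 ∈ S i.1 := fun i hi => Finset.mem_sigma.1 hi
  have hCS := sq_sum_measureReal_le volume I (fun i => ball i.2 (δ i.1))
    (fun i _ => isOpen_ball.measurableSet) (fun i _ => measure_ball_lt_top.ne)
  have hU : (⋃ i ∈ I, ball i.2 (δ i.1)) = ⋃ j ∈ J, ⋃ s ∈ S j, ball s (δ j) := by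
    ext y; simp only [Set.mem_iUnion, hI, Finset.mem_sigma, exists_prop]
    constructor
    · rintro ⟨i, ⟨h1, h2⟩, h3⟩; exact ⟨i.1, h1, i.2, h2, h3⟩
    · rintro ⟨j, h1, s, h2, h3⟩; exact ⟨⟨j, s⟩, ⟨h1, h2⟩, h3⟩
  rw [hU] at hCS
  set s := ∑ j ∈ J, a j with hs
  set V := volume.real (⋃ j ∈ J, ⋃ s ∈ S j, ball s (δ j)) with hV
  have hfirst : c * 2 ^ n * r ^ n * s ≤ ∑ i ∈ I, volume.real (ball i.2 (δ i.1)) := by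
    rw [hI, Finset.sum_sigma, hs, Finset.mul_sum]
    refine Finset.sum_le_sum fun j hj => ?_
    have h1 := hρ j hj
    have h2 := hδ j hj
    rw [Finset.sum_congr rfl fun s _ => volumeReal_pi_ball s h2, Finset.sum_const, nsmul_eq_mul]
    calc c * 2 ^ n * r ^ n * a j = c * (r / ρ j) ^ n * (2 * δ j) ^ n := by
          simp only [ha, div_pow, mul_pow]; field_simp
      _ ≤ _ := mul_le_mul_of_nonneg_right (hcard j hj) (by positivity)
  have hpair : ∀ j ∈ J, ∀ k ∈ J, j ≤ k →
      ∑ s ∈ S j, ∑ s' ∈ S k, volume.real (ball s (δ j) ∩ ball s' (δ k)) ≤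
        16 ^ n * r ^ n * (a j * a k + h j k * a j) := by
    intro j hj k hk hjk
    have := sum_volumeReal_inter_le hn z (S j) (S k) hr (hρ j hj) (hρ k hk) (hρr j hj) (hδ j hj)
      (hδ k hk) (e := (1 / 2) ^ (k - j)) (by positivity)
      (pow_le_one₀ (by norm_num) (by norm_num)) (hdecay j hj k hk hjk) (hdisj j hj) (hdisj k hk)
      (hS j hj)
    simpa only [ha, hh, if_pos hjk] using this
  have hpair' : ∀ j ∈ J, ∀ k ∈ J,
      ∑ s ∈ S j, ∑ s' ∈ S k, volume.real (ball s (δ j) ∩ ball s' (δ k)) ≤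
        16 ^ n * r ^ n * (a j * a k + h j k * a j + h k j * a k) := by
    intro j hj k hk
    have h16 : (0 : ℝ) < 16 ^ n * r ^ n := by positivity
    rcases le_total j k with hjk | hjk
    · refine (hpair j hj k hk hjk).trans (mul_le_mul_of_nonneg_left ?_ h16.le)
      have := mul_nonneg (hh0 k j) (ha0 k hk)
      linarith
    · rw [Finset.sum_comm]
      simp_rw [Set.inter_comm (ball _ (δ j))]
      refine (hpair k hk j hj hjk).trans (mul_le_mul_of_nonneg_left ?_ h16.le)
      have := mul_nonneg (hh0 j k) (ha0 j hj)
      linarith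
  have hsecond : ∑ i ∈ I, ∑ i' ∈ I, volume.real (ball i.2 (δ i.1) ∩ ball i'.2 (δ i'.1)) ≤
      16 ^ n * r ^ n * (5 * s ^ 2) := by
    have e1 : ∑ i ∈ I, ∑ i' ∈ I, volume.real (ball i.2 (δ i.1) ∩ ball i'.2 (δ i'.1)) =
        ∑ j ∈ J, ∑ k ∈ J, ∑ s ∈ S j, ∑ s' ∈ S k,
          volume.real (ball s (δ j) ∩ ball s' (δ k)) := by
      rw [hI, Finset.sum_sigma]
      refine Finset.sum_congr rfl fun j _ => ?_
      rw [Finset.sum_comm (s := J)]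
      refine Finset.sum_congr rfl fun t _ => ?_
      rw [Finset.sum_sigma]
    have e2 : ∑ j ∈ J, ∑ k ∈ J, h j k * a j ≤ 2 * s := by
      rw [hs, Finset.mul_sum]
      refine Finset.sum_le_sum fun j hj => ?_
      rw [← Finset.sum_mul]
      exact mul_le_mul_of_nonneg_right (sum_half_pow_sub_le J j) (ha0 j hj)
    have e3 : ∑ j ∈ J, ∑ k ∈ J, a j * a k = s ^ 2 := by rw [sq, hs, Finset.sum_mul_sum]
    have e4 : ∑ j ∈ J, ∑ k ∈ J, h k j * a k ≤ 2 * s := by rw [Finset.sum_comm]; exact e2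
    rw [e1]
    calc _ ≤ ∑ j ∈ J, ∑ k ∈ J, 16 ^ n * r ^ n * (a j * a k + h j k * a j + h k j * a k) :=
          Finset.sum_le_sum fun j hj => Finset.sum_le_sum fun k hk => hpair' j hj k hk
      _ = 16 ^ n * r ^ n * ∑ j ∈ J, ∑ k ∈ J, (a j * a k + h j k * a j + h k j * a k) := by
          simp_rw [Finset.mul_sum]
      _ ≤ _ := by
          simp_rw [Finset.sum_add_distrib]
          -- This is where total weight at least `1` is needed: the linear error is absorbed by the
          -- quadratic main term, so the final bound does not depend on `s`.
          have : s ≤ s ^ 2 := by nlinarith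
          gcongr
          linarith
  have hs0 : 0 < s := by linarith
  have hV0 : 0 ≤ V := measureReal_nonneg
  have hfin : (c * 2 ^ n * r ^ n * s) ^ 2 ≤ V * (16 ^ n * r ^ n * (5 * s ^ 2)) :=
    (pow_le_pow_left₀ (by positivity) hfirst 2).trans
      (hCS.trans (mul_le_mul_of_nonneg_left hsecond hV0))
  have h16 : (16 : ℝ) ^ n = (2 ^ n) ^ 2 * 4 ^ n := by
    rw [← pow_mul, mul_comm n 2, pow_mul, ← mul_pow]; norm_num
  rw [h16] at hfin
  rw [div_mul_eq_mul_div, div_le_iff₀ (by positivity)]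
  have hpos : (0 : ℝ) < (2 ^ n) ^ 2 * r ^ n * s ^ 2 := by positivity
  nlinarith

-- At almost every point outside `T` the density of `T` tends to `0`, which the uniform lower bound
-- rules out.
open MeasureTheory Metric Filter Topology in
theorem ae_mem_of_forall_volumeReal_ge {n : ℕ} {T : Set (Fin n → ℝ)} (hT : MeasurableSet T)
    {κ : ℝ} (hκ : 0 < κ)
    (h : ∀ z : Fin n → ℝ, ∀ r : ℝ, 0 < r → r ≤ 1 → κ * r ^ n ≤ volume.real (T ∩ closedBall z r)) :
    ∀ᵐ y, y ∈ T := by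
  filter_upwards [Besicovitch.ae_tendsto_measure_inter_div_of_measurableSet volume hT] with y hy
  by_contra hyT
  rw [Set.indicator_of_notMem hyT] at hy
  have hpos : (0 : ℝ≥0∞) < ENNReal.ofReal (κ / 2 ^ n) := by simp; positivity
  have h1 := (hy.eventually (gt_mem_nhds hpos)).and (Ioo_mem_nhdsGT (zero_lt_one' ℝ))
  obtain ⟨r, hr1, hr0, hr⟩ := h1.exists
  have h2 := h y r hr0 hr.le
  rw [Real.volume_pi_closedBall _ hr0.le, Fintype.card_fin,
    ENNReal.div_lt_iff (by left; simp; positivity) (by left; simp), ← ENNReal.ofReal_mul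
    (by positivity), mul_pow, div_mul_eq_mul_div, mul_left_comm,
    mul_div_cancel_left₀ _ (by positivity)] at hr1
  have hfin : volume (T ∩ closedBall y r) ≠ ∞ :=
    measure_ne_top_of_subset Set.inter_subset_right measure_closedBall_lt_top.ne
  rw [ENNReal.lt_ofReal_iff_toReal_lt hfin] at hr1
  rw [measureReal_def] at h2
  linarith

/-! ### Dirichlet's theorem and multiples of `x` near integers -/

/-- Simultaneous Dirichlet approximation with a separate quality for each coordinate. -/
theorem exists_simultaneous_approx {ι : Type*} [Fintype ι] (v : ι → ℝ) (m : ι → ℕ)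
    (hm : ∀ i, 1 ≤ m i) (N : ℕ) (hN : ∏ i, m i ≤ N) :
    ∃ q : ℕ, 1 ≤ q ∧ q ≤ N ∧ ∃ p : ι → ℤ, ∀ i, |(q : ℝ) * v i - p i| < 1 / m i := by
  classical
  -- Pigeonhole: the `N + 1` multiples `q = 0, …, N` fall into `∏ m i ≤ N` boxes, and the difference
  -- of two in the same box is the required denominator.
  set f : ℕ → ι → ℕ := fun q i => ⌊Int.fract ((q : ℝ) * v i) * m i⌋₊ with hf
  have hmaps : Set.MapsTo f (Finset.range (N + 1))
      (Fintype.piFinset fun i => Finset.range (m i) : Finset (ι → ℕ)) := by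
    intro q _
    rw [Finset.mem_coe, Fintype.mem_piFinset]
    intro i
    have hmi : (0 : ℝ) < m i := by exact_mod_cast hm i
    rw [Finset.mem_range, hf, Nat.floor_lt (mul_nonneg (Int.fract_nonneg _) hmi.le)]
    nlinarith [Int.fract_lt_one ((q : ℝ) * v i)]
  have hcard : (Fintype.piFinset fun i => Finset.range (m i) : Finset (ι → ℕ)).card <
      (Finset.range (N + 1)).card := by
    rw [Fintype.card_piFinset]; simp only [Finset.card_range]; omega
  obtain ⟨q₁, h₁, q₂, h₂, hne, heq⟩ := Finset.exists_ne_map_eq_of_card_lt_of_maps_to hcard hmaps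
  wlog hlt : q₁ < q₂ generalizing q₁ q₂
  · exact this q₂ h₂ q₁ h₁ hne.symm heq.symm (by omega)
  rw [Finset.mem_range] at h₁ h₂
  refine ⟨q₂ - q₁, by omega, by omega,
    fun i => ⌊(q₂ : ℝ) * v i⌋ - ⌊(q₁ : ℝ) * v i⌋, fun i => ?_⟩
  have hmi : (0 : ℝ) < m i := by exact_mod_cast hm i
  have h3 : ⌊Int.fract ((q₁ : ℝ) * v i) * m i⌋₊ = ⌊Int.fract ((q₂ : ℝ) * v i) * m i⌋₊ :=
    congrFun heq i
  have e1 := Nat.floor_le (mul_nonneg (Int.fract_nonneg ((q₁ : ℝ) * v i)) hmi.le)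
  have e2 := Nat.floor_le (mul_nonneg (Int.fract_nonneg ((q₂ : ℝ) * v i)) hmi.le)
  have e3 := Nat.lt_floor_add_one (Int.fract ((q₁ : ℝ) * v i) * m i)
  have e4 := Nat.lt_floor_add_one (Int.fract ((q₂ : ℝ) * v i) * m i)
  rw [h3] at e1 e3
  have e5 : ((q₂ - q₁ : ℕ) : ℝ) * v i -
      ((⌊(q₂ : ℝ) * v i⌋ - ⌊(q₁ : ℝ) * v i⌋ : ℤ) : ℝ) =
      Int.fract ((q₂ : ℝ) * v i) - Int.fract ((q₁ : ℝ) * v i) := by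
    rw [Nat.cast_sub hlt.le, Int.cast_sub, Int.fract, Int.fract]; ring
  rw [e5, lt_div_iff₀ hmi, ← abs_of_pos hmi, ← abs_mul, sub_mul, abs_lt]
  constructor <;> linarith

/-- By coprimality `h a / b` is not an integer, so it is at least `1/b` from every integer;
replacing `a/b` by `x` moves it by at most `h/b² ≤ 1/(2b)`. -/
theorem one_div_two_mul_le_abs_sub {x : ℝ} {a : ℤ} {b : ℕ} (hab : IsCoprime a (b : ℤ))
    (hx : |(b : ℝ) * x - a| ≤ 1 / b) {h : ℕ} (h1 : 1 ≤ h) (h2 : 2 * h ≤ b) (p : ℤ) :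
    1 / (2 * (b : ℝ)) ≤ |(h : ℝ) * x - p| := by
  have hb : (0 : ℝ) < b := by exact_mod_cast (by omega : 0 < b)
  have hne : (h : ℤ) * a - p * b ≠ 0 := by
    intro h0
    have hd : (b : ℤ) ∣ h * a := ⟨p, by linarith⟩
    have := Int.le_of_dvd (by omega) (hab.symm.dvd_of_dvd_mul_right hd)
    omega
  have h3 : (1 : ℝ) ≤ |(h : ℝ) * a - p * b| := by exact_mod_cast Int.one_le_abs hne
  have h4 : (b : ℝ) * ((h : ℝ) * x - p) = h * (b * x - a) + (h * a - p * b) := by ring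
  have h5 : |(h : ℝ) * (b * x - a)| ≤ 1 / 2 := by
    rw [abs_mul, Nat.abs_cast]
    calc (h : ℝ) * |(b : ℝ) * x - a| ≤ h * (1 / b) := by gcongr
      _ ≤ 1 / 2 := by
        rw [mul_one_div, div_le_div_iff₀ hb two_pos]
        exact_mod_cast (by omega : h * 2 ≤ 1 * b)
  have h6 : (1 : ℝ) / 2 ≤ b * |(h : ℝ) * x - p| := by
    rw [← abs_of_pos hb, ← abs_mul, h4]
    have := abs_sub_abs_le_abs_add ((h : ℝ) * a - p * b) ((h : ℝ) * (b * x - a))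
    rw [add_comm] at this
    linarith
  rw [← div_div, div_le_iff₀ hb]
  linarith

-- Among at most `b/2 + 1` consecutive `q`, the residues `qx - p` are `1/(2b)`-separated, so at most
-- `4φb + 1` of them lie in `(-φ, φ)`. There are at most `2M/b + 1` such runs; `1 ≤ φb` and `b ≤ M`
-- absorb the added ones, giving `3 · 5 = 15`.
open Classical in
theorem card_filter_approx_le {x : ℝ} {a : ℤ} {b : ℕ} (hb : 1 ≤ b) (hab : IsCoprime a (b : ℤ))
    (hx : |(b : ℝ) * x - a| ≤ 1 / b) {φ : ℝ} (hφ : 1 ≤ φ * b) {M : ℕ} (hM : b ≤ M) :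
    (((Finset.Icc 1 M).filter fun q : ℕ => ∃ p : ℤ, |(q : ℝ) * x - p| < φ).card : ℝ) ≤
      15 * M * φ := by
  set F := (Finset.Icc 1 M).filter fun q : ℕ => ∃ p : ℤ, |(q : ℝ) * x - p| < φ with hF
  have hb0 : (0 : ℝ) < b := by exact_mod_cast hb
  have hp : ∀ q, ∃ p : ℤ, q ∈ F → |(q : ℝ) * x - p| < φ := fun q => by
    by_cases hq : q ∈ F
    · obtain ⟨p, hp⟩ := (Finset.mem_filter.1 hq).2
      exact ⟨p, fun _ => hp⟩
    · exact ⟨0, fun h => absurd h hq⟩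
  choose p hp using hp
  -- The run containing `q`, and the cell of width `1/(2b)` containing the residue.
  set f : ℕ → ℕ × ℕ := fun q => (q / (b / 2 + 1), ⌊((q : ℝ) * x - p q + φ) * (2 * b)⌋₊) with hf
  have hmaps : Set.MapsTo f F
      ((Finset.range (M / (b / 2 + 1) + 1)) ×ˢ (Finset.range (⌊4 * (φ * b)⌋₊ + 1)) :
        Finset (ℕ × ℕ)) := by
    intro q hq
    have hq' := Finset.mem_Icc.1 (Finset.mem_filter.1 (Finset.mem_coe.1 hq)).1
    have h1 := abs_lt.1 (hp q hq)
    rw [Finset.mem_coe, Finset.mem_product, Finset.mem_range, Finset.mem_range]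
    refine ⟨Nat.lt_succ_of_le (Nat.div_le_div_right hq'.2),
      Nat.lt_succ_of_le (Nat.floor_le_floor ?_)⟩
    nlinarith
  have haux : ∀ q ∈ F, ∀ q' ∈ F, f q = f q' → ¬ q' < q := by
    intro q hq q' hq' heq hlt
    obtain ⟨h1, h2⟩ := Prod.mk.inj heq
    have hle : 2 * (q - q') ≤ b := by
      have e1 := Nat.div_add_mod q (b / 2 + 1)
      have e2 := Nat.div_add_mod q' (b / 2 + 1)
      have e3 := Nat.mod_lt q (by omega : b / 2 + 1 > 0)
      rw [h1] at e1
      omega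
    have h3 := one_div_two_mul_le_abs_sub hab hx (h := q - q') (by omega) hle (p q - p q')
    have g1 := abs_lt.1 (hp q hq)
    have g2 := abs_lt.1 (hp q' hq')
    have e1 := Nat.floor_le (a := ((q : ℝ) * x - p q + φ) * (2 * b))
      (mul_nonneg (by linarith) (by positivity))
    have e2 := Nat.floor_le (a := ((q' : ℝ) * x - p q' + φ) * (2 * b))
      (mul_nonneg (by linarith) (by positivity))
    have e3 := Nat.lt_floor_add_one (((q : ℝ) * x - p q + φ) * (2 * b))
    have e4 := Nat.lt_floor_add_one (((q' : ℝ) * x - p q' + φ) * (2 * b))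
    rw [h2] at e1 e3
    rw [div_le_iff₀ (by positivity), ← abs_of_pos (by positivity : (0 : ℝ) < 2 * b), ← abs_mul,
      Nat.cast_sub hlt.le, Int.cast_sub] at h3
    refine absurd h3 (not_le.2 (abs_lt.2 ⟨?_, ?_⟩)) <;> linarith
  have hinj : Set.InjOn f F := fun q hq q' hq' heq =>
    le_antisymm (not_lt.1 (haux q hq q' hq' heq)) (not_lt.1 (haux q' hq' q hq heq.symm))
  have hcard := Finset.card_le_card_of_injOn f hmaps hinj
  rw [Finset.card_product, Finset.card_range, Finset.card_range] at hcard
  have hM0 : (b : ℝ) ≤ M := by exact_mod_cast hM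
  have h1 : ((M / (b / 2 + 1) : ℕ) : ℝ) ≤ 2 * M / b := by
    refine Nat.cast_div_le.trans ?_
    rw [div_le_div_iff₀ (by positivity) hb0]
    have : (b : ℝ) ≤ 2 * ((b / 2 + 1 : ℕ) : ℝ) := by exact_mod_cast (by omega)
    nlinarith
  have h2 : (⌊4 * (φ * b)⌋₊ : ℝ) ≤ 4 * (φ * b) := Nat.floor_le (by linarith)
  have h3 : (1 : ℝ) ≤ M / b := by rwa [one_le_div hb0]
  calc (F.card : ℝ) ≤ ((M / (b / 2 + 1) : ℕ) + 1) * ((⌊4 * (φ * b)⌋₊ : ℝ) + 1) := by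
        exact_mod_cast hcard
    _ ≤ (3 * (M / b)) * (5 * (φ * b)) := by
        gcongr
        · rw [mul_div_assoc] at h1; linarith
        · linarith
    _ = 15 * M * φ := by field_simp; ring

/-! ### Well separated rational points in the fiber -/

-- The set is covered by balls of radius `θ/q` about points `p/q`; each coordinate of `p` lies in an
-- interval of length `2(qr + θ)`, hence takes at most `2qr + 3` values.
open MeasureTheory Metric in
theorem volumeReal_closedBall_inter_approx_le {n : ℕ} (z : Fin n → ℝ) {r θ : ℝ} (hr : 0 < r)
    (hθ : 0 < θ) (hθ1 : θ ≤ 1) {q : ℕ} (hq : 1 ≤ q) :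
    volume.real (closedBall z r ∩ {y | ∃ p : Fin n → ℤ, ∀ i, |(q : ℝ) * y i - p i| < θ}) ≤
      ((2 * q * r + 3) * (2 * (θ / q))) ^ n := by
  have hq0 : (0 : ℝ) < q := by exact_mod_cast hq
  set P : Finset (Fin n → ℤ) := Fintype.piFinset fun i =>
    Finset.Icc ⌈(q : ℝ) * z i - q * r - θ⌉ ⌊(q : ℝ) * z i + q * r + θ⌋ with hP
  have hsub : closedBall z r ∩ {y | ∃ p : Fin n → ℤ, ∀ i, |(q : ℝ) * y i - p i| < θ} ⊆
      ⋃ p ∈ P, ball (fun i => (p i : ℝ) / q) (θ / q) := by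
    rintro y ⟨hy, p, hp⟩
    rw [mem_closedBall, dist_pi_le_iff hr.le] at hy
    refine Set.mem_biUnion (x := p) ?_ ?_
    · rw [Finset.mem_coe, hP, Fintype.mem_piFinset]
      intro i
      have h1 := abs_lt.1 (hp i)
      have h2 := abs_le.1 (hy i)
      rw [Finset.mem_Icc, Int.ceil_le, Int.le_floor]
      constructor <;> nlinarith
    · rw [mem_ball, dist_pi_lt_iff (by positivity)]
      intro i
      rw [Real.dist_eq, lt_div_iff₀ hq0, ← abs_of_pos hq0, ← abs_mul, abs_of_pos hq0, sub_mul,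
        div_mul_cancel₀ _ hq0.ne', mul_comm]
      exact hp i
  have hcard : (P.card : ℝ) ≤ (2 * q * r + 3) ^ n := by
    rw [hP, Fintype.card_piFinset, Nat.cast_prod]
    refine (Finset.prod_le_prod (g := fun _ => 2 * q * r + 3) (fun i _ => Nat.cast_nonneg _)
      fun i _ => ?_).trans (by simp)
    rw [Int.card_Icc]
    have h1 := Int.le_ceil ((q : ℝ) * z i - q * r - θ)
    have h2 := Int.floor_le ((q : ℝ) * z i + q * r + θ)
    have h3 : (((⌊(q : ℝ) * z i + q * r + θ⌋ + 1 - ⌈(q : ℝ) * z i - q * r - θ⌉).toNat : ℤ) : ℝ) ≤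
        max ((⌊(q : ℝ) * z i + q * r + θ⌋ : ℝ) + 1 - ⌈(q : ℝ) * z i - q * r - θ⌉) 0 := by
      rw [Int.toNat_eq_max]; push_cast; exact le_rfl
    rw [Int.cast_natCast] at h3
    refine h3.trans (max_le ?_ (by positivity))
    linarith
  calc _ ≤ volume.real (⋃ p ∈ P, ball (fun i => (p i : ℝ) / q) (θ / q)) := by
        refine measureReal_mono hsub
          (measure_biUnion_lt_top P.finite_toSet fun p _ => measure_ball_lt_top).ne
    _ ≤ ∑ p ∈ P, volume.real (ball (fun i => (p i : ℝ) / q) (θ / q)) :=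
        measureReal_biUnion_finset_le _ _
    _ = P.card * (2 * (θ / q)) ^ n := by
        rw [Finset.sum_congr rfl fun p _ => volumeReal_pi_ball _ (by positivity)]; simp
    _ ≤ _ := by rw [mul_pow (2 * (q : ℝ) * r + 3)]; gcongr

theorem exists_nat_pow_between {n : ℕ} (hn : 1 ≤ n) {X : ℝ} (hX : 2 ≤ X) :
    ∃ t : ℕ, 1 ≤ t ∧ 2 * (t : ℝ) ^ n ≤ X ∧ X ≤ 2 ^ (n + 1) * (t : ℝ) ^ n := by
  have hbound : ∃ t : ℕ, ¬ (2 * ((t : ℝ) + 1) ^ n ≤ X) := by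
    obtain ⟨t, ht⟩ := exists_nat_gt X
    refine ⟨t, fun h => ?_⟩
    have : (t : ℝ) + 1 ≤ ((t : ℝ) + 1) ^ n := le_self_pow₀ (by simp) (by omega)
    linarith
  classical
  have h1 := Nat.find_spec hbound
  have hpos : 1 ≤ Nat.find hbound := by
    by_contra h0
    have : Nat.find hbound = 0 := by omega
    rw [this] at h1
    simp at h1
    linarith
  have h2 := Nat.find_min hbound (m := Nat.find hbound - 1) (by omega)
  rw [not_not, Nat.cast_sub hpos] at h2
  refine ⟨Nat.find hbound, hpos, by simpa using h2, ?_⟩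
  have h3 : (1 : ℝ) ≤ Nat.find hbound := by exact_mod_cast hpos
  calc X ≤ 2 * ((Nat.find hbound : ℝ) + 1) ^ n := (not_le.1 h1).le
    _ ≤ 2 * (2 * (Nat.find hbound : ℝ)) ^ n := by gcongr; linarith
    _ = _ := by rw [mul_pow]; ring

open MeasureTheory Metric in
theorem finite_of_disjoint_closedBall {n : ℕ} {u : Set (Fin n → ℝ)} {ρ R : ℝ} (hρ : 0 < ρ)
    (z : Fin n → ℝ) (hdisj : u.PairwiseDisjoint fun s => closedBall s ρ)
    (hu : u ⊆ closedBall z R) : u.Finite := by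
  have h := Measure.finite_const_le_meas_of_disjoint_iUnion (ι := u)
    (volume : Measure (Fin n → ℝ))
    (ε := ENNReal.ofReal ((2 * ρ) ^ n)) (by simp; positivity)
    (As := fun s => closedBall (s : Fin n → ℝ) ρ) (fun s => isClosed_closedBall.measurableSet)
    (fun s s' hss => hdisj s.2 s'.2 fun h => hss (Subtype.ext h))
    (measure_ne_top_of_subset (s := closedBall z (R + ρ))
      (Set.iUnion_subset fun s => closedBall_subset_closedBall' (by
        have := mem_closedBall.1 (hu s.2); linarith)) measure_closedBall_lt_top.ne)
  have h2 : {s : u | ENNReal.ofReal ((2 * ρ) ^ n) ≤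
      volume (closedBall (s : Fin n → ℝ) ρ)} = Set.univ := by
    ext s
    simp [Real.volume_pi_closedBall _ hρ.le]
  rw [h2] at h
  exact Set.finite_univ_iff.1 h

-- The part of the ball served by denominators too small to be useful. A denominator with `qr ≥ 1`
-- serves volume at most `(10r/t)^n`, and the number of admissible `q` is at most `15εNφ ≤ 15ε
-- 2^(n+1) t^n`; the condition on `ε` makes the total at most a quarter of the ball. The at most
-- `1/r` remaining denominators serve `(10/t)^n` each, another quarter at most because `t` is large.
open MeasureTheory Metric Classical in
theorem volumeReal_biUnion_approx_le {n : ℕ} {ε : ℝ} (hε0 : 0 < ε) (hε : 120 * 10 ^ n * ε ≤ 1)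
    {r : ℝ} (hr : 0 < r) {x φ : ℝ} (hφ0 : 0 < φ) {N : ℕ} {a : ℤ} {b : ℕ} (hb : 1 ≤ b)
    (hab : IsCoprime a (b : ℤ)) (hx : |(b : ℝ) * x - a| ≤ 1 / b) (hφb : 1 ≤ φ * b)
    (hbN : (b : ℝ) ≤ ε * N) {t : ℕ} (ht : 1 ≤ t) (ht2 : N * φ ≤ 2 ^ (n + 1) * (t : ℝ) ^ n)
    (ht3 : 4 * 10 ^ n / (r * (2 * r) ^ n) ≤ (t : ℝ) ^ n) (z : Fin n → ℝ) :
    volume.real (⋃ q ∈ (Finset.Icc 1 ⌊ε * N⌋₊).filter fun q : ℕ => ∃ p : ℤ, |(q : ℝ) * x - p| < φ,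
      closedBall z r ∩ {y | ∃ p : Fin n → ℤ, ∀ i, |(q : ℝ) * y i - p i| < 1 / t}) ≤
      (2 * r) ^ n / 2 := by
  set F := (Finset.Icc 1 ⌊ε * N⌋₊).filter fun q : ℕ => ∃ p : ℤ, |(q : ℝ) * x - p| < φ with hF
  have ht0 : (0 : ℝ) < t := by exact_mod_cast ht
  have ht1 : (1 : ℝ) / t ≤ 1 := by rw [div_le_one ht0]; exact_mod_cast ht
  have hterm : ∀ q ∈ F, volume.real (closedBall z r ∩
      {y | ∃ p : Fin n → ℤ, ∀ i, |(q : ℝ) * y i - p i| < 1 / t}) ≤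
      (10 * r * (1 / t)) ^ n + if q ≤ ⌊1 / r⌋₊ then (10 * (1 / (t : ℝ))) ^ n else 0 := by
    intro q hq
    have hq1 : 1 ≤ q := (Finset.mem_Icc.1 (Finset.mem_filter.1 hq).1).1
    have hq0 : (1 : ℝ) ≤ q := by exact_mod_cast hq1
    refine (volumeReal_closedBall_inter_approx_le z hr (by positivity) ht1 hq1).trans ?_
    rcases le_total 1 ((q : ℝ) * r) with h | h
    · have h1 : (2 * q * r + 3) * (2 * (1 / (t : ℝ) / q)) ≤ 10 * r * (1 / t) := by
        calc (2 * q * r + 3) * (2 * (1 / (t : ℝ) / q)) ≤ (5 * (q * r)) * (2 * (1 / (t : ℝ) / q)) := by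
              gcongr; linarith
          _ = _ := by field_simp; norm_num
      refine (pow_le_pow_left₀ (by positivity) h1 n).trans (le_add_of_nonneg_right ?_)
      split_ifs <;> positivity
    · have h1 : (2 * q * r + 3) * (2 * (1 / (t : ℝ) / q)) ≤ 10 * (1 / t) := by
        calc (2 * q * r + 3) * (2 * (1 / (t : ℝ) / q)) ≤ 5 * (2 * (1 / (t : ℝ) / 1)) := by
              gcongr; linarith
          _ = _ := by ring
      have h2 : q ≤ ⌊1 / r⌋₊ := Nat.le_floor (by rwa [le_div_iff₀ hr])
      rw [if_pos h2]
      exact (pow_le_pow_left₀ (by positivity) h1 n).trans (le_add_of_nonneg_left (by positivity))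
  have hcard := card_filter_approx_le hb hab hx hφb (M := ⌊ε * N⌋₊) (Nat.le_floor hbN)
  rw [← hF] at hcard
  have hfloor : (⌊ε * N⌋₊ : ℝ) ≤ ε * N := Nat.floor_le (by positivity)
  have hsmall : ((F.filter (· ≤ ⌊1 / r⌋₊)).card : ℝ) ≤ 1 / r := by
    have h1 : (F.filter (· ≤ ⌊1 / r⌋₊)).card ≤ (Finset.Icc 1 ⌊1 / r⌋₊).card := by
      refine Finset.card_le_card fun q hq => ?_
      have h2 := Finset.mem_filter.1 hq
      exact Finset.mem_Icc.2 ⟨(Finset.mem_Icc.1 (Finset.mem_filter.1 h2.1).1).1, h2.2⟩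
    rw [Nat.card_Icc, Nat.add_sub_cancel] at h1
    exact (Nat.cast_le.2 h1).trans (Nat.floor_le (by positivity))
  have htn : (0 : ℝ) < (t : ℝ) ^ n := by positivity
  calc _ ≤ ∑ q ∈ F, volume.real (closedBall z r ∩
        {y | ∃ p : Fin n → ℤ, ∀ i, |(q : ℝ) * y i - p i| < 1 / t}) :=
        measureReal_biUnion_finset_le _ _
    _ ≤ ∑ q ∈ F, ((10 * r * (1 / t)) ^ n +
          if q ≤ ⌊1 / r⌋₊ then (10 * (1 / (t : ℝ))) ^ n else 0) := Finset.sum_le_sum hterm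
    _ = F.card * (10 * r * (1 / t)) ^ n +
          (F.filter (· ≤ ⌊1 / r⌋₊)).card * (10 * (1 / (t : ℝ))) ^ n := by
        rw [Finset.sum_add_distrib, ← Finset.sum_filter]; simp
    _ ≤ (15 * (ε * (2 ^ (n + 1) * t ^ n))) * (10 * r * (1 / t)) ^ n +
          (1 / r) * (10 * (1 / (t : ℝ))) ^ n := by
        gcongr
        calc (F.card : ℝ) ≤ 15 * ⌊ε * N⌋₊ * φ := hcard
          _ ≤ 15 * (ε * N) * φ := by gcongr
          _ = 15 * (ε * (N * φ)) := by ring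
          _ ≤ _ := by gcongr
    _ = (120 * 10 ^ n * ε) * ((2 * r) ^ n / 4) +
          (4 * 10 ^ n / (r * (2 * r) ^ n)) / t ^ n * ((2 * r) ^ n / 4) := by
        simp only [mul_pow, div_pow, one_pow, pow_succ]
        field_simp
        ring
    _ ≤ 1 * ((2 * r) ^ n / 4) + 1 * ((2 * r) ^ n / 4) := by
        gcongr
        rw [div_le_one htn]
        exact ht3
    _ = _ := by ring

open MeasureTheory Metric Classical in
/-- At a scale where `x` has a suitable denominator `b`, there are many well separated rational
points `p / q` with `q` of size comparable to `N` and `q x` close to an integer. -/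
theorem exists_separated_centers {n : ℕ} (hn : 1 ≤ n) {ε : ℝ} (hε0 : 0 < ε)
    (hε : 120 * 10 ^ n * ε ≤ 1) {r : ℝ} (hr : 0 < r) :
    ∃ X₀ : ℝ, ∀ (x φ : ℝ) (N : ℕ) (a : ℤ) (b : ℕ), 0 < φ → φ ≤ 1 → 1 ≤ b → IsCoprime a (b : ℤ) →
      |(b : ℝ) * x - a| ≤ 1 / b → 1 ≤ φ * b → (b : ℝ) ≤ ε * N → X₀ ≤ N * φ →
      ∀ z : Fin n → ℝ, ∃ (t : ℕ) (S : Finset (Fin n → ℝ)), 1 ≤ t ∧ 2 * (t : ℝ) ^ n ≤ N * φ ∧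
        N * φ ≤ 2 ^ (n + 1) * (t : ℝ) ^ n ∧ 1 / (t * (ε * N)) ≤ r ∧
        ((S : Set (Fin n → ℝ)).PairwiseDisjoint fun s => closedBall s (1 / (t * (ε * N)))) ∧
        (∀ s ∈ S, s ∈ closedBall z (2 * r)) ∧
        1 / (2 * 10 ^ n) * (2 * r / (1 / (t * (ε * N)))) ^ n ≤ S.card ∧
        ∀ s ∈ S, ∃ q : ℕ, ε * N < q ∧ q ≤ N ∧ (∃ p : ℤ, |(q : ℝ) * x - p| < φ) ∧
          ∃ p : Fin n → ℤ, s = fun i => (p i : ℝ) / q := by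
  -- The three summands respectively allow the choice of `t`, make `t^n` large enough for the bad
  -- set to fill at most half the ball, and ensure `ρ ≤ r`.
  refine ⟨2 + 2 ^ (n + 1) * (4 * 10 ^ n / (r * (2 * r) ^ n)) + 1 / (ε * r), ?_⟩
  intro x φ N a b hφ0 hφ1 hb hab hx hφb hbN hX z
  have hA : 0 < 4 * 10 ^ n / (r * (2 * r) ^ n) := by positivity
  have hA' : 0 < 2 ^ (n + 1) * (4 * 10 ^ n / (r * (2 * r) ^ n)) := by positivity
  have hB : 0 < 1 / (ε * r) := by positivity
  obtain ⟨t, ht, ht1, ht2⟩ := exists_nat_pow_between hn (X := N * φ) (by linarith)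
  have ht0 : (1 : ℝ) ≤ t := by exact_mod_cast ht
  have ht3 : 4 * 10 ^ n / (r * (2 * r) ^ n) ≤ (t : ℝ) ^ n := by
    have : (0 : ℝ) < 2 ^ (n + 1) := by positivity
    nlinarith
  have hbad := volumeReal_biUnion_approx_le hε0 hε hr hφ0 hb hab hx hφb hbN ht ht2 ht3 z
  set F := (Finset.Icc 1 ⌊ε * N⌋₊).filter fun q : ℕ => ∃ p : ℤ, |(q : ℝ) * x - p| < φ with hF
  have hb0 : (1 : ℝ) ≤ b := by exact_mod_cast hb
  have hεN : 0 < ε * N := by linarith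
  have hN0 : (0 : ℝ) < N := pos_of_mul_pos_right hεN hε0.le
  set ρ : ℝ := 1 / (t * (ε * N)) with hρ
  have hρ0 : 0 < ρ := by positivity
  have hρr : ρ ≤ r := by
    have h1 : 1 / (ε * r) ≤ N := by nlinarith
    rw [div_le_iff₀ (by positivity)] at h1
    rw [hρ, div_le_iff₀ (by positivity)]
    calc (1 : ℝ) ≤ 1 * (r * (ε * N)) := by linarith
      _ ≤ t * (r * (ε * N)) := by gcongr
      _ = _ := by ring
  set C : Set (Fin n → ℝ) := {s | s ∈ closedBall z (2 * r) ∧ ∃ q : ℕ, ε * N < q ∧ q ≤ N ∧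
    (∃ p : ℤ, |(q : ℝ) * x - p| < φ) ∧ ∃ p : Fin n → ℤ, s = fun i => (p i : ℝ) / q} with hC
  -- A disjoint subfamily whose fivefold enlargements still cover everything the candidate centres
  -- cover.
  obtain ⟨u, huC, hdisj, hcov⟩ := Vitali.exists_disjoint_subfamily_covering_enlargement_closedBall
    C (fun s => s) (fun _ => ρ) ρ (fun _ _ => le_rfl) 5 (by norm_num)
  have hufin : u.Finite := finite_of_disjoint_closedBall hρ0 z hdisj fun s hs => (huC hs).1
  refine ⟨t, hufin.toFinset, ht, ht1, ht2, hρr, by rwa [hufin.coe_toFinset],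
    fun s hs => (huC (hufin.mem_toFinset.1 hs)).1, ?_, fun s hs => (huC (hufin.mem_toFinset.1 hs)).2⟩
  have hsub : closedBall z r ⊆ (⋃ q ∈ F, closedBall z r ∩
      {y | ∃ p : Fin n → ℤ, ∀ i, |(q : ℝ) * y i - p i| < 1 / t}) ∪
      ⋃ s ∈ hufin.toFinset, closedBall s (5 * ρ) := by
    intro y hy
    -- Dirichlet in `n + 1` coordinates, with quality `⌈1/φ⌉` for `x` and `t` for each `y i`;
    -- admissible since `⌈1/φ⌉ t^n ≤ 2 t^n / φ ≤ N`.
    obtain ⟨q, hq1, hqN, p, hp⟩ := exists_simultaneous_approx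
      (fun o : Option (Fin n) => o.elim x y) (fun o => o.elim ⌈1 / φ⌉₊ fun _ => t)
      (fun o => by
        cases o with
        | none => exact Nat.ceil_pos.2 (by positivity)
        | some i => exact ht) N (by
        rw [Fintype.prod_option]
        simp only [Option.elim, Finset.prod_const, Finset.card_univ, Fintype.card_fin]
        have h1 : (⌈1 / φ⌉₊ : ℝ) ≤ 2 / φ := by
          refine (Nat.ceil_lt_add_one (by positivity)).le.trans ?_
          rw [div_add_one hφ0.ne']
          gcongr
          linarith
        have h2 : ((⌈1 / φ⌉₊ * t ^ n : ℕ) : ℝ) ≤ N := by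
          push_cast
          calc (⌈1 / φ⌉₊ : ℝ) * t ^ n ≤ 2 / φ * t ^ n := by gcongr
            _ = 2 * t ^ n / φ := by ring
            _ ≤ N := by rwa [div_le_iff₀ hφ0]
        exact_mod_cast h2)
    have hpx : |(q : ℝ) * x - p none| < φ := by
      refine (hp none).trans_le ?_
      simp only [Option.elim]
      rw [one_div_le (by exact_mod_cast Nat.ceil_pos.2 (by positivity)) hφ0]
      exact Nat.le_ceil _
    have hpy : ∀ i, |(q : ℝ) * y i - p (some i)| < 1 / t := fun i => hp (some i)
    have hq0 : (0 : ℝ) < q := by exact_mod_cast hq1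
    by_cases hq : (q : ℝ) ≤ ε * N
    · left
      refine Set.mem_biUnion (x := q) ?_ ⟨hy, fun i => p (some i), hpy⟩
      exact Finset.mem_filter.2 ⟨Finset.mem_Icc.2 ⟨hq1, Nat.le_floor hq⟩, _, hpx⟩
    · right
      push Not at hq
      have hdist : dist y (fun i => (p (some i) : ℝ) / q) ≤ ρ := by
        rw [dist_pi_le_iff hρ0.le]
        intro i
        have h1 : |y i - (p (some i) : ℝ) / q| * q ≤ 1 / t := by
          rw [← abs_of_pos hq0, ← abs_mul, abs_of_pos hq0, sub_mul, div_mul_cancel₀ _ hq0.ne',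
            mul_comm]
          exact (hpy i).le
        rw [Real.dist_eq, hρ, ← div_div, le_div_iff₀ hεN]
        exact (mul_le_mul_of_nonneg_left hq.le (abs_nonneg _)).trans h1
      have hmem : (fun i => (p (some i) : ℝ) / q) ∈ C := by
        refine ⟨?_, q, hq, hqN, ⟨_, hpx⟩, _, rfl⟩
        rw [mem_closedBall] at hy ⊢
        have := dist_triangle_left (fun i => (p (some i) : ℝ) / q) z y
        linarith
      obtain ⟨s, hs, hss⟩ := hcov _ hmem
      exact Set.mem_biUnion (x := s) (by simpa using hs) (hss (mem_closedBall.2 hdist))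
  -- The bad set fills at most half of the ball, so the enlarged balls must account for the other
  -- half; this bounds their number from below.
  have hmeas : (2 * r) ^ n ≤ (2 * r) ^ n / 2 + hufin.toFinset.card * (2 * (5 * ρ)) ^ n := by
    rw [← volumeReal_pi_closedBall z hr.le]
    refine (measureReal_mono hsub ?_).trans ((measureReal_union_le _ _).trans (add_le_add ?_ ?_))
    · refine measure_union_ne_top ?_ ?_
      · exact (measure_biUnion_lt_top F.finite_toSet fun q _ =>
          (measure_mono Set.inter_subset_left).trans_lt measure_closedBall_lt_top).ne
      · exact (measure_biUnion_lt_top hufin.toFinset.finite_toSet fun q _ =>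
          measure_closedBall_lt_top).ne
    · rw [volumeReal_pi_closedBall z hr.le]; exact hbad
    · refine (measureReal_biUnion_finset_le _ _).trans ?_
      rw [Finset.sum_congr rfl fun s _ => volumeReal_pi_closedBall s (by positivity)]
      simp
  have h10 : (2 * (5 * ρ)) ^ n = 10 ^ n * ρ ^ n := by rw [← mul_pow]; ring
  rw [h10] at hmeas
  rw [div_pow, div_mul_div_comm, one_mul, div_le_iff₀ (by positivity)]
  linarith

/-! ### Full fibers from divergence along good scales -/

/-- The points `y` such that `(x, y)` is `ψ`-approximable with some denominator `q ≥ m`. -/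
def tailApproximable (n : ℕ) (ψ : ℕ → ℝ) (x : ℝ) (m : ℕ) : Set (Fin n → ℝ) :=
  {y | ∃ q : ℕ, m ≤ q ∧ 1 ≤ q ∧ (∃ p : ℤ, |(q : ℝ) * x - p| < ψ q) ∧
    ∃ p : Fin n → ℤ, ∀ i, |(q : ℝ) * y i - p i| < ψ q}

theorem cons_mem_approximable {n : ℕ} {ψ : ℕ → ℝ} {x : ℝ} {y : Fin n → ℝ}
    (h : ∀ m, y ∈ tailApproximable n ψ x m) :
    (Fin.cons x y : Fin (n + 1) → ℝ) ∈ approximable (n + 1) ψ := by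
  intro hfin
  obtain ⟨B, hB⟩ := (hfin.image Prod.snd).bddAbove
  obtain ⟨q, hq, hq1, ⟨p₀, hp₀⟩, p, hp⟩ := h (B + 1)
  have : q ≤ B := by
    refine hB ⟨(Fin.cons p₀ p, q), ⟨hq1, ?_⟩, rfl⟩
    rw [pi_norm_lt_iff ((abs_nonneg _).trans_lt hp₀)]
    intro i
    refine Fin.cases ?_ (fun i => ?_) i
    · simpa using hp₀
    · simpa using hp i
  omega

theorem isOpen_tailApproximable (n : ℕ) (ψ : ℕ → ℝ) (x : ℝ) (m : ℕ) :
    IsOpen (tailApproximable n ψ x m) := by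
  simp only [tailApproximable, Set.ofPred_exists, Set.ofPred_and, Set.ofPred_forall]
  refine isOpen_iUnion fun q => isOpen_const.inter (isOpen_const.inter (IsOpen.inter ?_ ?_))
  · exact isOpen_iUnion fun p => isOpen_const
  · refine isOpen_iUnion fun p => isOpen_iInter_of_finite fun i => ?_
    exact isOpen_lt (by fun_prop) continuous_const

theorem fullFiber_of_ae_mem {n : ℕ} {ψ : ℕ → ℝ} {x : ℝ}
    (h : ∀ m, ∀ᵐ y, y ∈ tailApproximable n ψ x m) : FullFiber n ψ x := by
  filter_upwards [MeasureTheory.ae_all_iff.2 h] with y hy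
  exact cons_mem_approximable hy

theorem exists_finset_sum_ge {f : ℕ → ℝ} (hf : ∀ k, 0 ≤ f k) {K : Set ℕ}
    (h : ¬ Summable (K.indicator f)) (k₀ : ℕ) (B : ℝ) :
    ∃ J : Finset ℕ, (∀ k ∈ J, k ∈ K ∧ k₀ ≤ k) ∧ B ≤ ∑ k ∈ J, f k := by
  classical
  by_contra! hcon
  refine h ((summable_nat_add_iff k₀).1 (summable_of_sum_le (c := B)
    (fun i => Set.indicator_nonneg (fun k _ => hf k) _) fun u => ?_))
  have hlt := hcon ((u.map (addRightEmbedding k₀)).filter (· ∈ K)) fun k hk => by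
    obtain ⟨h1, h2⟩ := Finset.mem_filter.1 hk
    obtain ⟨i, _, rfl⟩ := Finset.mem_map.1 h1
    exact ⟨h2, by simp⟩
  rw [Finset.sum_filter, Finset.sum_map] at hlt
  simpa [Set.indicator_apply] using hlt.le

open MeasureTheory Metric in
/-- If the volume sum diverges along scales `2 ^ k` at which `x` has a coprime approximation
`a / b` with `1 / φ k ≤ b ≤ ε 2 ^ k`, then almost every point of the fiber over `x` is
`ψ`-approximable. -/
theorem fullFiber_of_scales {n : ℕ} (hn : 1 ≤ n) {ε : ℝ} (hε0 : 0 < ε)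
    (hε : 120 * 10 ^ n * ε ≤ 1) {ψ : ℕ → ℝ} (hψ : IsApproximatingFunction ψ) {x : ℝ} {φ : ℕ → ℝ}
    (hφ0 : ∀ k, 0 < φ k) (hanti : Antitone φ) (hφ1 : ∀ k, 2 ^ k * φ k ^ (n + 1) ≤ 1)
    (hφψ : ∀ k, φ k ≤ ψ (2 ^ k)) {K : Set ℕ}
    (hdiv : ¬ Summable (K.indicator fun k => 2 ^ k * φ k ^ (n + 1)))
    (hK5 : ∀ k ∈ K, 1 ≤ φ k ^ 5 * 4 ^ k)
    (hK : ∀ k ∈ K, ∃ (a : ℤ) (b : ℕ), 1 ≤ b ∧ IsCoprime a (b : ℤ) ∧ |(b : ℝ) * x - a| ≤ 1 / b ∧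
      1 ≤ φ k * b ∧ (b : ℝ) ≤ ε * 2 ^ k) : FullFiber n ψ x := by
  refine fullFiber_of_ae_mem fun m => ?_
  set c : ℝ := 1 / (2 * 10 ^ n) with hc
  have hc0 : 0 < c := by positivity
  refine ae_mem_of_forall_volumeReal_ge (isOpen_tailApproximable n ψ x m).measurableSet
    (κ := c ^ 2 / (5 * 4 ^ n) * (2 / 3) ^ n) (by positivity) fun z r hr _ => ?_
  have hle1 : ∀ k, φ k ≤ 1 := fun k => by
    have h1 : φ k ^ (n + 1) ≤ 1 := by
      have h2 : (1 : ℝ) ≤ 2 ^ k := one_le_pow₀ one_le_two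
      have h3 : 0 < φ k ^ (n + 1) := pow_pos (hφ0 k) _
      nlinarith [hφ1 k]
    exact (pow_le_one_iff_of_nonneg (hφ0 k).le (by omega)).1 h1
  -- With `r / 3` the centres lie within `2r/3` of `z`, and the balls of radius at most `r/3` around
  -- them stay inside the ball of radius `r`.
  obtain ⟨X₀, hX₀⟩ := exists_separated_centers hn hε0 hε (r := r / 3) (by positivity)
  obtain ⟨k₁, hk₁⟩ := pow_unbounded_of_one_lt X₀ (by norm_num : (1 : ℝ) < 3 / 2)
  obtain ⟨k₂, hk₂⟩ := pow_unbounded_of_one_lt (m / ε) one_lt_two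
  -- On `K` the quantity `2^k φ k` grows exponentially: its fifth power is at least `8^k`, and
  -- `(3/2)^5 ≤ 8`.
  have hX : ∀ k ∈ K, k₁ ≤ k → X₀ ≤ 2 ^ k * φ k := fun k hk hkk => by
    have h1 : ((3 / 2 : ℝ) ^ k) ^ 5 ≤ (2 ^ k * φ k) ^ 5 := by
      calc ((3 / 2 : ℝ) ^ k) ^ 5 = ((3 / 2) ^ 5) ^ k := by rw [← pow_mul, ← pow_mul, mul_comm]
        _ ≤ 8 ^ k := by gcongr; norm_num
        _ ≤ 8 ^ k * (φ k ^ 5 * 4 ^ k) := le_mul_of_one_le_right (by positivity) (hK5 k hk)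
        _ = (2 ^ k * φ k) ^ 5 := by
          rw [mul_pow, ← pow_mul, mul_comm k 5, pow_mul, show ((2 : ℝ) ^ 5) = 8 * 4 by norm_num,
            mul_pow]; ring
    have h2 := (pow_le_pow_iff_left₀ (by positivity)
      (mul_pos (by positivity) (hφ0 k)).le (by norm_num)).1 h1
    exact hk₁.le.trans ((pow_le_pow_right₀ (by norm_num) hkk).trans h2)
  have hw0 : ∀ k, 0 ≤ 2 ^ k * φ k ^ (n + 1) := fun k =>
    mul_nonneg (by positivity) (pow_nonneg (hφ0 k).le _)
  -- The bound `2^(n+1)/ε^n` is what the comparison of `2^k φ^(n+1)` with `(δ/ρ)^n = (φ t ε)^n`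
  -- costs. Taking `k ≥ k₂` forces `q > ε 2^k > m`.
  obtain ⟨J, hJ, hsum⟩ := exists_finset_sum_ge hw0 hdiv (max k₁ k₂) (2 ^ (n + 1) / ε ^ n)
  have hex : ∀ k, ∃ (t : ℕ) (S : Finset (Fin n → ℝ)), k ∈ J → (1 ≤ t ∧
      2 * (t : ℝ) ^ n ≤ (2 ^ k : ℕ) * φ k ∧
      (2 ^ k : ℕ) * φ k ≤ 2 ^ (n + 1) * (t : ℝ) ^ n ∧ 1 / (t * (ε * (2 ^ k : ℕ))) ≤ r / 3 ∧
      ((S : Set (Fin n → ℝ)).PairwiseDisjoint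
        fun s => closedBall s (1 / (t * (ε * (2 ^ k : ℕ))))) ∧
      (∀ s ∈ S, s ∈ closedBall z (2 * (r / 3))) ∧
      1 / (2 * 10 ^ n) * (2 * (r / 3) / (1 / (t * (ε * (2 ^ k : ℕ))))) ^ n ≤ S.card ∧
      ∀ s ∈ S, ∃ q : ℕ, ε * (2 ^ k : ℕ) < q ∧ q ≤ 2 ^ k ∧ (∃ p : ℤ, |(q : ℝ) * x - p| < φ k) ∧
        ∃ p : Fin n → ℤ, s = fun i => (p i : ℝ) / q) := fun k => by
    by_cases hk : k ∈ J
    · obtain ⟨hkK, hkk⟩ := hJ k hk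
      obtain ⟨a, b, hb, hab, hx, hφb, hbN⟩ := hK k hkK
      obtain ⟨t, S, h⟩ := hX₀ x (φ k) (2 ^ k) a b (hφ0 k) (hle1 k) hb hab hx hφb
        (by push_cast; exact hbN) (by push_cast; exact hX k hkK (le_trans (le_max_left _ _) hkk)) z
      exact ⟨t, S, fun _ => h⟩
    · exact ⟨0, ∅, fun h => absurd h hk⟩
  choose t S hts using hex
  push_cast at hts
  have hδρ : ∀ k ∈ J, φ k / 2 ^ k / (1 / (t k * (ε * 2 ^ k))) = φ k * (t k * ε) := fun k _ => by
    field_simp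
  have htφ : ∀ k ∈ J, φ k * t k ≤ 1 := fun k hk => by
    obtain ⟨h1, h2, -⟩ := hts k hk
    have h3 : (φ k * t k) ^ n ≤ 1 := by
      calc (φ k * t k) ^ n = φ k ^ n * t k ^ n := mul_pow _ _ _
        _ ≤ φ k ^ n * (2 ^ k * φ k) := by
          have : (0 : ℝ) ≤ (t k : ℝ) ^ n := by positivity
          exact mul_le_mul_of_nonneg_left (by linarith) (pow_nonneg (hφ0 k).le _)
        _ = 2 ^ k * φ k ^ (n + 1) := by ring
        _ ≤ 1 := hφ1 k
    exact (pow_le_one_iff_of_nonneg (mul_nonneg (hφ0 k).le (Nat.cast_nonneg _)) (by omega)).1 h3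
  have ht0 : ∀ k ∈ J, (0 : ℝ) < t k := fun k hk => by exact_mod_cast (hts k hk).1
  have hρ0 : ∀ k ∈ J, 0 < 1 / ((t k : ℝ) * (ε * 2 ^ k)) := fun k hk => by
    have := ht0 k hk; positivity
  have hε1 : ε ≤ 1 := by
    have : (1 : ℝ) ≤ 10 ^ n := one_le_pow₀ (by norm_num)
    nlinarith
  have hδle : ∀ k ∈ J, φ k / 2 ^ k ≤ 1 / ((t k : ℝ) * (ε * 2 ^ k)) := fun k hk => by
    rw [← div_le_one (hρ0 k hk), hδρ k hk, ← mul_assoc]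
    have := ht0 k hk
    have := hφ0 k
    exact mul_le_one₀ (htφ k hk) hε0.le hε1
  have hmain := volumeReal_biUnion_ball_ge hn (r := 2 * (r / 3)) (c := c) (by positivity) hc0 z J S
    (fun k => 1 / (t k * (ε * 2 ^ k))) (fun k => φ k / 2 ^ k) hρ0
    (fun k hk => (hts k hk).2.2.2.1.trans (by linarith))
    (fun k hk => div_pos (hφ0 k) (by positivity))
    (fun j _ k _ hjk => by
      obtain ⟨i, rfl⟩ := Nat.exists_eq_add_of_le hjk
      rw [Nat.add_sub_cancel_left, pow_add, ← div_div, one_div_pow, one_div_mul_eq_div]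
      have := hanti hjk
      gcongr)
    (fun k hk => (hts k hk).2.2.2.2.1) (fun k hk => (hts k hk).2.2.2.2.2.1)
    (fun k hk => (hts k hk).2.2.2.2.2.2.1) (by
      have h1 : ∀ k ∈ J, ε ^ n / 2 ^ (n + 1) * (2 ^ k * φ k ^ (n + 1)) ≤
          (φ k / 2 ^ k / (1 / (t k * (ε * 2 ^ k)))) ^ n := fun k hk => by
        rw [hδρ k hk]
        have h2 := (hts k hk).2.2.1
        calc ε ^ n / 2 ^ (n + 1) * (2 ^ k * φ k ^ (n + 1))
            = ε ^ n / 2 ^ (n + 1) * φ k ^ n * (2 ^ k * φ k) := by ring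
          _ ≤ ε ^ n / 2 ^ (n + 1) * φ k ^ n * (2 ^ (n + 1) * t k ^ n) :=
            mul_le_mul_of_nonneg_left h2 (mul_nonneg (by positivity) (pow_nonneg (hφ0 k).le _))
          _ = (φ k * (t k * ε)) ^ n := by simp only [mul_pow]; field_simp
      refine le_trans ?_ (Finset.sum_le_sum h1)
      rw [← Finset.mul_sum]
      rw [div_le_iff₀ (by positivity)] at hsum
      rw [div_mul_eq_mul_div, le_div_iff₀ (by positivity)]
      linarith)
  -- Since `q ≤ 2^k`, being within `φ k / 2^k` of `p/q` gives `|q y_i - p_i| < φ k ≤ ψ(2^k) ≤ ψ(q)`.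
  have hsub : (⋃ j ∈ J, ⋃ s ∈ S j, ball s (φ j / 2 ^ j)) ⊆
      tailApproximable n ψ x m ∩ closedBall z r := by
    refine Set.iUnion₂_subset fun k hk => Set.iUnion₂_subset fun s hs y hy => ?_
    obtain ⟨h1, h2, h3, hρr, h5, hS, h7, hq⟩ := hts k hk
    obtain ⟨q, hεq, hqN, ⟨p₀, hp₀⟩, p, rfl⟩ := hq s hs
    have hmq : (m : ℝ) < q := by
      have h6 : (2 : ℝ) ^ k₂ ≤ 2 ^ k :=
        pow_le_pow_right₀ one_le_two (le_trans (le_max_right _ _) (hJ k hk).2)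
      rw [div_lt_iff₀ hε0] at hk₂
      nlinarith
    have hq1 : 1 ≤ q := by
      have : m < q := by exact_mod_cast hmq
      omega
    have hq0 : (0 : ℝ) < q := by exact_mod_cast hq1
    have hqN' : (q : ℝ) ≤ 2 ^ k := by exact_mod_cast hqN
    have hψq : φ k ≤ ψ q := (hφψ k).trans (hψ.antitone q _ hq1 hqN)
    refine ⟨⟨q, by exact_mod_cast hmq.le, hq1, ⟨p₀, hp₀.trans_le hψq⟩, p, fun i => ?_⟩, ?_⟩
    · have hd : |y i - (p i : ℝ) / q| < φ k / 2 ^ k := (dist_le_pi_dist y _ i).trans_lt hy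
      refine lt_of_lt_of_le ?_ hψq
      have e1 : (q : ℝ) * y i - p i = q * (y i - p i / q) := by field_simp
      rw [lt_div_iff₀ (by positivity)] at hd
      rw [e1, abs_mul, abs_of_pos hq0]
      refine lt_of_le_of_lt ?_ hd
      rw [mul_comm]
      exact mul_le_mul_of_nonneg_left hqN' (abs_nonneg _)
    · have h8 := mem_closedBall.1 (hS _ hs)
      have h9 := dist_triangle y (fun i => (p i : ℝ) / q) z
      have h10 := (mem_ball.1 hy).le.trans ((hδle k hk).trans hρr)
      rw [mem_closedBall]
      linarith
  calc c ^ 2 / (5 * 4 ^ n) * (2 / 3) ^ n * r ^ n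
      = c ^ 2 / (5 * 4 ^ n) * (2 * (r / 3)) ^ n := by rw [mul_assoc, ← mul_pow]; ring
    _ ≤ _ := hmain
    _ ≤ _ := measureReal_mono hsub
        (measure_ne_top_of_subset Set.inter_subset_right measure_closedBall_lt_top.ne)

/-! ### Condensation, truncation and the choice of scales -/

theorem IsApproximatingFunction.pos_of_not_summable {ψ : ℕ → ℝ} (hψ : IsApproximatingFunction ψ)
    {n : ℕ} (hdiv : ¬ Summable fun q : ℕ => ψ q ^ (n + 1)) {q : ℕ} (hq : 1 ≤ q) : 0 < ψ q := by
  refine (hψ.nonneg q hq).lt_of_ne fun h0 => hdiv ?_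
  refine summable_of_ne_finset_zero (s := Finset.range q) fun r hr => ?_
  have hqr : q ≤ r := by simpa using hr
  have : ψ r = 0 := le_antisymm (h0 ▸ hψ.antitone q r hq hqr) (hψ.nonneg r (hq.trans hqr))
  simp [this]

theorem IsApproximatingFunction.not_summable_condensed {ψ : ℕ → ℝ}
    (hψ : IsApproximatingFunction ψ) {n : ℕ} (hdiv : ¬ Summable fun q : ℕ => ψ q ^ (n + 1)) :
    ¬ Summable fun k : ℕ => (2 : ℝ) ^ k * ψ (2 ^ k) ^ (n + 1) := by
  intro h
  -- Nothing is assumed about `ψ 0`, so Cauchy condensation is applied to a copy that vanishes at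
  -- `0`.
  set f : ℕ → ℝ := fun q => if q = 0 then 0 else ψ q ^ (n + 1) with hf
  have hf' : ∀ q, q ≠ 0 → f q = ψ q ^ (n + 1) := fun q hq => by simp [hf, hq]
  have h1 : Summable f := by
    refine (summable_condensed_iff_of_nonneg (fun q => ?_) fun q r hq hqr => ?_).1 ?_
    · by_cases hq : q = 0
      · simp [hf, hq]
      · rw [hf' q hq]; exact pow_nonneg (hψ.nonneg q (by omega)) _
    · rw [hf' q (by omega), hf' r (by omega)]
      exact pow_le_pow_left₀ (hψ.nonneg r (by omega)) (hψ.antitone q r hq hqr) _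
    · simpa [hf] using h
  refine hdiv ((summable_nat_add_iff 1).1 ?_)
  exact ((summable_nat_add_iff 1).2 h1).congr fun q => hf' _ (by omega)

/-- Cutting `ψ(2^k)` down to `2^(-k/(n+1))` makes every term at most `1` and keeps divergence: if
the truncated series converged, its terms would eventually be below `1`, so the cut would be
inactive and the condensed series would converge. Discarding the scales with `φ < 2^(-2k/5)` costs
at most `∑ 2^k φ³ ≤ ∑ 2^(-k/5)`; three powers of `φ` are needed, whence `n ≥ 2`. -/
theorem exists_truncation {n : ℕ} (hn : 2 ≤ n) {ψ : ℕ → ℝ} (hψ : IsApproximatingFunction ψ)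
    (hdiv : ¬ Summable fun q : ℕ => ψ q ^ (n + 1)) :
    ∃ φ : ℕ → ℝ, (∀ k, 0 < φ k) ∧ Antitone φ ∧ (∀ k, 2 ^ k * φ k ^ (n + 1) ≤ 1) ∧
      (∀ k, φ k ≤ ψ (2 ^ k)) ∧
      ¬ Summable ({k | 1 ≤ φ k ^ 5 * 4 ^ k}.indicator fun k => 2 ^ k * φ k ^ (n + 1)) := by
  obtain ⟨θ, hθ0, hθ⟩ : ∃ θ : ℝ, 0 < θ ∧ θ ^ (n + 1) = 1 / 2 :=
    ⟨(1 / 2 : ℝ) ^ ((n + 1 : ℕ) : ℝ)⁻¹, by positivity,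
      Real.rpow_inv_natCast_pow (by norm_num) (by omega)⟩
  have hθ1 : θ ≤ 1 := (pow_le_one_iff_of_nonneg hθ0.le (by omega)).1 (hθ.le.trans (by norm_num))
  have hψ0 : ∀ k, 0 < ψ (2 ^ k) := fun k => hψ.pos_of_not_summable hdiv Nat.one_le_two_pow
  set φ : ℕ → ℝ := fun k => min (ψ (2 ^ k)) (θ ^ k) with hφ
  have hφ0 : ∀ k, 0 < φ k := fun k => lt_min (hψ0 k) (by positivity)
  have hθk : ∀ k, 2 ^ k * (θ ^ k) ^ (n + 1) = 1 := fun k => by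
    rw [← pow_mul, mul_comm k, pow_mul, hθ, ← mul_pow]; norm_num
  have hφ1 : ∀ k, 2 ^ k * φ k ^ (n + 1) ≤ 1 := fun k => by
    rw [← hθk k]
    exact mul_le_mul_of_nonneg_left (pow_le_pow_left₀ (hφ0 k).le (min_le_right _ _) _)
      (by positivity)
  refine ⟨φ, hφ0, ?_, hφ1, fun k => min_le_left _ _, fun hsum => ?_⟩
  · intro j k hjk
    exact min_le_min (hψ.antitone _ _ Nat.one_le_two_pow (Nat.pow_le_pow_right two_pos hjk))
      (pow_le_pow_of_le_one hθ0.le hθ1 hjk)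
  have hv0 : ∀ k, 0 ≤ 2 ^ k * φ k ^ (n + 1) := fun k =>
    mul_nonneg (by positivity) (pow_nonneg (hφ0 k).le _)
  have hsmall : ∀ k, φ k ^ 5 * 4 ^ k < 1 → 2 ^ k * φ k ^ (n + 1) ≤ (9 / 10) ^ k := by
    intro k hk
    have hle1 : φ k ≤ 1 := (min_le_right _ _).trans (pow_le_one₀ hθ0.le hθ1)
    have h0 := hφ0 k
    have h1 : 2 ^ k * φ k ^ (n + 1) ≤ 2 ^ k * φ k ^ 3 :=
      mul_le_mul_of_nonneg_left (pow_le_pow_of_le_one h0.le hle1 (by omega)) (by positivity)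
    refine h1.trans ((pow_le_pow_iff_left₀ (by positivity) (by positivity)
      (by norm_num : (5 : ℕ) ≠ 0)).1 ?_)
    calc (2 ^ k * φ k ^ 3) ^ 5 = (φ k ^ 5 * 4 ^ k) ^ 3 * (1 / 2) ^ k := by
          have : ((2 : ℝ) ^ k) ^ 5 = (4 ^ k) ^ 3 * (1 / 2) ^ k := by
            rw [← pow_mul, ← pow_mul, mul_comm k 5, mul_comm k 3, pow_mul, pow_mul, ← mul_pow]
            norm_num
          rw [mul_pow, this]; ring
      _ ≤ 1 * (1 / 2) ^ k := by
          gcongr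
          exact pow_le_one₀ (by positivity) hk.le
      _ ≤ ((9 / 10) ^ 5) ^ k := by rw [one_mul]; gcongr; norm_num
      _ = ((9 / 10) ^ k) ^ 5 := by rw [← pow_mul, ← pow_mul, mul_comm]
  have hv : Summable fun k => 2 ^ k * φ k ^ (n + 1) := by
    refine Summable.of_nonneg_of_le hv0 (fun k => ?_)
      (hsum.add (summable_geometric_of_lt_one (r := 9 / 10) (by norm_num) (by norm_num)))
    by_cases hk : 1 ≤ φ k ^ 5 * 4 ^ k
    · rw [Set.indicator_of_mem (by exact hk)]
      have : (0 : ℝ) < (9 / 10) ^ k := by positivity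
      linarith
    · rw [Set.indicator_of_notMem (by exact hk), zero_add]
      exact hsmall k (not_le.1 hk)
  have hev := hv.tendsto_atTop_zero.eventually (gt_mem_nhds zero_lt_one)
  obtain ⟨k₀, hk₀⟩ := Filter.eventually_atTop.1 hev
  refine hψ.not_summable_condensed hdiv ((summable_nat_add_iff k₀).1
    (((summable_nat_add_iff k₀).2 hv).congr fun i => ?_))
  have h1 := hk₀ (i + k₀) (by omega)
  have h2 : φ (i + k₀) = ψ (2 ^ (i + k₀)) := by
    -- If the minimum were the cut-off `θ^(i+k₀)`, the term would equal `1`, contrary to its being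
    -- below `1`.
    rcases min_choice (ψ (2 ^ (i + k₀))) (θ ^ (i + k₀)) with h | h
    · exact h
    · rw [show φ (i + k₀) = θ ^ (i + k₀) from h, hθk] at h1
      exact absurd h1 (lt_irrefl _)
  rw [h2]

theorem not_summable_indicator_inter_Ici {f : ℕ → ℝ} {K : Set ℕ}
    (h : ¬ Summable (K.indicator f)) (k₀ : ℕ) : ¬ Summable ((K ∩ Set.Ici k₀).indicator f) := by
  intro hs
  have heq : ∀ i, (K ∩ Set.Ici k₀).indicator f (i + k₀) = K.indicator f (i + k₀) := fun i => by
    by_cases hi : i + k₀ ∈ K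
    · rw [Set.indicator_of_mem hi, Set.indicator_of_mem (show i + k₀ ∈ K ∩ Set.Ici k₀ from ⟨hi, by simp⟩)]
    · rw [Set.indicator_of_notMem hi, Set.indicator_of_notMem fun h => hi h.1]
  exact h ((summable_nat_add_iff k₀).1 (((summable_nat_add_iff k₀).2 hs).congr heq))

/-- On `K` one has `φ² 2^k ≥ 2^(k/5) → ∞`. Hence a denominator whose square is comparable to `2^k`
or larger satisfies `φ b ≥ 1` at all large scales, and the lower bound on `b` no longer involves
`φ`. -/
theorem fullFiber_of_sq_ge {n : ℕ} (hn : 1 ≤ n) {ε : ℝ} (hε0 : 0 < ε)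
    (hε : 120 * 10 ^ n * ε ≤ 1) {ψ : ℕ → ℝ} (hψ : IsApproximatingFunction ψ) {x : ℝ} {φ : ℕ → ℝ}
    (hφ0 : ∀ k, 0 < φ k) (hanti : Antitone φ) (hφ1 : ∀ k, 2 ^ k * φ k ^ (n + 1) ≤ 1)
    (hφψ : ∀ k, φ k ≤ ψ (2 ^ k)) {K : Set ℕ}
    (hdiv : ¬ Summable (K.indicator fun k => 2 ^ k * φ k ^ (n + 1)))
    (hK5 : ∀ k ∈ K, 1 ≤ φ k ^ 5 * 4 ^ k) {C : ℝ} (hC : 0 < C)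
    (hK : ∀ k ∈ K, ∃ (a : ℤ) (b : ℕ), 1 ≤ b ∧ IsCoprime a (b : ℤ) ∧ |(b : ℝ) * x - a| ≤ 1 / b ∧
      (b : ℝ) ≤ ε * 2 ^ k ∧ ε * 2 ^ k ≤ C * (b : ℝ) ^ 2) : FullFiber n ψ x := by
  obtain ⟨k₀, hk₀⟩ := pow_unbounded_of_one_lt ((C / ε) ^ 5) one_lt_two
  refine fullFiber_of_scales hn hε0 hε hψ hφ0 hanti hφ1 hφψ
    (not_summable_indicator_inter_Ici hdiv k₀) (fun k hk => hK5 k hk.1) fun k hk => ?_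
  obtain ⟨a, b, hb, hab, hx, hbN, hCb⟩ := hK k hk.1
  refine ⟨a, b, hb, hab, hx, ?_, hbN⟩
  have h0 := hφ0 k
  have h1 : (C / ε) ^ 5 ≤ (φ k ^ 2 * 2 ^ k) ^ 5 := calc
    (C / ε) ^ 5 ≤ 2 ^ k := hk₀.le.trans (pow_le_pow_right₀ one_le_two hk.2)
    _ ≤ (φ k ^ 5 * 4 ^ k) ^ 2 * 2 ^ k :=
      le_mul_of_one_le_left (by positivity) (one_le_pow₀ (hK5 k hk.1))
    _ = (φ k ^ 2 * 2 ^ k) ^ 5 := by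
      have : ((2 : ℝ) ^ k) ^ 5 = (4 ^ k) ^ 2 * 2 ^ k := by
        rw [← pow_mul, ← pow_mul, mul_comm k 5, mul_comm k 2, pow_mul, pow_mul, ← mul_pow]
        norm_num
      rw [mul_pow (φ k ^ 2), this]; ring
  have h2 := (pow_le_pow_iff_left₀ (by positivity) (by positivity) (by norm_num)).1 h1
  have h3 : 1 ≤ (φ k * b) ^ 2 := by
    rw [div_le_iff₀ hε0] at h2
    have h4 : C ≤ C * (φ k * b) ^ 2 := by
      calc C ≤ φ k ^ 2 * (ε * 2 ^ k) := by linarith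
        _ ≤ φ k ^ 2 * (C * (b : ℝ) ^ 2) := by gcongr
        _ = _ := by ring
    exact (le_mul_iff_one_le_right hC).1 h4
  exact (one_le_sq_iff₀ (by positivity)).1 h3

/-! ### Rational fibers -/

/-- The fiber over a rational number: every point is approximable. -/
theorem fullFiber_ratCast {n : ℕ} (hn : 1 ≤ n) {ψ : ℕ → ℝ} (hψ : IsApproximatingFunction ψ)
    (hdiv : ¬ Summable fun q : ℕ => ψ q ^ (n + 1)) (x : ℚ) : FullFiber n ψ x := by
  -- Otherwise `ψ(c t^n) < 1/t` for every `t ≥ 1`, so `ψ(q)^(n+1) = O(q^(-(n+1)/n))` by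
  -- monotonicity, a summable bound.
  have key : ∀ c : ℕ, 1 ≤ c → ∃ t : ℕ, 1 ≤ t ∧ 1 / (t : ℝ) ≤ ψ (c * t ^ n) := by
    intro c hc
    by_contra! hcon
    have hc0 : (0 : ℝ) < c := by exact_mod_cast hc
    have hn0 : (n : ℝ) ≠ 0 := by exact_mod_cast (by omega : n ≠ 0)
    have hexp : (1 : ℝ) < (n + 1) / n := by
      rw [one_lt_div (by positivity)]; linarith
    have hs : Summable fun q : ℕ => (2 : ℝ) ^ (n + 1) * (2 * (c : ℝ)) ^ (((n : ℝ) + 1) / n) *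
        ((q : ℝ) ^ (((n : ℝ) + 1) / n))⁻¹ :=
      (Real.summable_nat_rpow_inv.2 hexp).mul_left _
    refine hdiv ((summable_nat_add_iff (2 * c)).1 (Summable.of_nonneg_of_le (fun q => ?_)
      (fun i => ?_) ((summable_nat_add_iff (2 * c)).2 hs)))
    · exact pow_nonneg (hψ.nonneg _ (by omega)) _
    set q := i + 2 * c with hq
    have hq0 : (0 : ℝ) < q := by exact_mod_cast (by omega : 0 < q)
    have hqc : 2 ≤ (q : ℝ) / c := by
      rw [le_div_iff₀ hc0]; exact_mod_cast (by omega : 2 * c ≤ q)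
    obtain ⟨t, ht, ht1, ht2⟩ := exists_nat_pow_between hn hqc
    have ht0 : (0 : ℝ) < t := by exact_mod_cast ht
    have hle : c * t ^ n ≤ q := by
      have : (c : ℝ) * t ^ n ≤ q := by
        rw [le_div_iff₀ hc0] at ht1
        have : (0 : ℝ) < t ^ n * c := by positivity
        linarith
      exact_mod_cast this
    have h1 : ψ q ≤ 1 / t := (hψ.antitone _ _ (Nat.mul_pos hc (pow_pos ht n)) hle).trans
      (hcon t ht).le
    have h2 : 1 / (t : ℝ) ≤ 2 * (2 * c / q) ^ ((1 : ℝ) / n) := by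
      have h3 : (1 / (2 * (t : ℝ))) ^ n ≤ 2 * c / q := by
        rw [div_pow, one_pow, div_le_div_iff₀ (by positivity) hq0, mul_pow]
        rw [div_le_iff₀ hc0] at ht2
        calc 1 * (q : ℝ) ≤ 2 ^ (n + 1) * t ^ n * c := by linarith
          _ = _ := by ring
      have h4 := Real.rpow_le_rpow (by positivity) h3 (by positivity : 0 ≤ (1 : ℝ) / n)
      rw [one_div (n : ℝ), Real.pow_rpow_inv_natCast (by positivity) (by omega)] at h4
      rw [one_div (n : ℝ)]
      calc 1 / (t : ℝ) = 2 * (1 / (2 * t)) := by field_simp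
        _ ≤ _ := by gcongr
    calc ψ q ^ (n + 1) ≤ (2 * (2 * c / q) ^ ((1 : ℝ) / n)) ^ (n + 1) :=
          pow_le_pow_left₀ (hψ.nonneg _ (by omega)) (h1.trans h2) _
      _ = 2 ^ (n + 1) * (2 * c / (q : ℝ)) ^ (((n : ℝ) + 1) / n) := by
          rw [mul_pow, ← Real.rpow_natCast ((2 * c / (q : ℝ)) ^ ((1 : ℝ) / n)),
            ← Real.rpow_mul (by positivity)]
          congr 2
          push_cast; ring
      _ = _ := by
          rw [Real.div_rpow (by positivity) hq0.le]; ring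
  refine fullFiber_of_ae_mem fun m => Filter.Eventually.of_forall fun y => ?_
  -- The factor `x.den` makes `c x` an integer; the factor `m + 1` makes every multiple of `c`
  -- exceed `m`.
  set c := (m + 1) * x.den with hc
  have hc1 : 1 ≤ c := Nat.mul_pos (by omega) x.den_pos
  obtain ⟨t, ht, htψ⟩ := key c hc1
  obtain ⟨k, hk1, hk2, p, hp⟩ := exists_simultaneous_approx (fun i => (c : ℝ) * y i)
    (fun _ : Fin n => t) (fun _ => ht) (t ^ n) (by simp)
  have hckt : ψ (c * t ^ n) ≤ ψ (c * k) :=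
    hψ.antitone _ _ (Nat.mul_pos hc1 hk1) (Nat.mul_le_mul_left c hk2)
  refine ⟨c * k, ?_, Nat.mul_pos hc1 hk1, ⟨(m + 1) * k * x.num, ?_⟩, p, fun i => ?_⟩
  · calc m ≤ (m + 1) * 1 * 1 := by omega
      _ ≤ _ := Nat.mul_le_mul (Nat.mul_le_mul_left _ x.den_pos) hk1
  · have h1 : ((c * k : ℕ) : ℝ) * (x : ℝ) - (((m + 1) * k * x.num : ℤ) : ℝ) = 0 := by
      have h2 : (x : ℝ) = x.num / x.den := Rat.cast_def x
      have h3 : (x.den : ℝ) ≠ 0 := by exact_mod_cast x.den_nz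
      rw [h2, hc]; push_cast; field_simp; ring
    rw [h1, abs_zero]
    exact hψ.pos_of_not_summable hdiv (Nat.mul_pos hc1 hk1)
  · have := (hp i).trans_le (htψ.trans hckt)
    rwa [mul_left_comm, ← mul_assoc, ← Nat.cast_mul] at this

/-! ### Continued fractions: continuants and prescribed partial quotients -/

/-- `x = [a₀; A 0, A 1, …]` is irrational with convergents `P k / Q k`. -/
structure HasContinuedFraction (x : ℝ) (A Q : ℕ → ℕ) (P : ℕ → ℤ) : Prop where
  irrational : Irrational x
  partialQuotient_eq : ∀ k, partialQuotient x (k + 1) = A k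
  continuant_eq : ∀ k, continuant x k = Q k
  one_le_quotient : ∀ k, 1 ≤ A k
  den_zero : Q 0 = 1
  den_one : Q 1 = A 0
  den_add_two : ∀ k, Q (k + 2) = A (k + 1) * Q (k + 1) + Q k
  coprime : ∀ k, IsCoprime (P k) (Q k : ℤ)
  abs_sub_le : ∀ k, |(Q k : ℝ) * x - P k| ≤ 1 / Q (k + 1)

namespace HasContinuedFraction

variable {x : ℝ} {A Q : ℕ → ℕ} {P : ℕ → ℤ}

theorem den_pos (h : HasContinuedFraction x A Q P) (k : ℕ) : 1 ≤ Q k := by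
  induction k using Nat.twoStepInduction with
  | zero => exact h.den_zero.ge
  | one => rw [h.den_one]; exact h.one_le_quotient 0
  | more k ih _ => rw [h.den_add_two]; omega

theorem quotient_mul_den_le (h : HasContinuedFraction x A Q P) (k : ℕ) :
    A k * Q k ≤ Q (k + 1) := by
  cases k with
  | zero => rw [h.den_zero, zero_add, h.den_one, mul_one]
  | succ k => rw [h.den_add_two]; omega

theorem den_succ_mono (h : HasContinuedFraction x A Q P) (k : ℕ) : Q k ≤ Q (k + 1) :=
  (Nat.le_mul_of_pos_left _ (h.one_le_quotient k)).trans (h.quotient_mul_den_le k)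

theorem den_mono (h : HasContinuedFraction x A Q P) : Monotone Q :=
  monotone_nat_of_le_succ h.den_succ_mono

theorem den_succ_le (h : HasContinuedFraction x A Q P) (k : ℕ) : Q (k + 1) ≤ (A k + 1) * Q k := by
  cases k with
  | zero => rw [h.den_zero, zero_add, h.den_one]; omega
  | succ k => rw [h.den_add_two, add_mul, one_mul]; have := h.den_succ_mono k; omega

theorem den_lt_succ (h : HasContinuedFraction x A Q P) (k : ℕ) : Q (k + 1) < Q (k + 2) := by
  have h1 := h.den_add_two k
  have h2 := h.den_pos k
  have h3 := Nat.le_mul_of_pos_left (Q (k + 1)) (h.one_le_quotient (k + 1))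
  omega

theorem le_den (h : HasContinuedFraction x A Q P) (k : ℕ) : k ≤ Q k := by
  induction k using Nat.twoStepInduction with
  | zero => omega
  | one => exact h.den_pos 1
  | more k _ ih => have := h.den_lt_succ k; omega

theorem two_mul_den_le (h : HasContinuedFraction x A Q P) (k : ℕ) : 2 * Q k ≤ Q (k + 2) := by
  have h1 := h.den_add_two k
  have h3 := Nat.le_mul_of_pos_left (Q (k + 1)) (h.one_le_quotient (k + 1))
  have h4 := h.den_succ_mono k
  omega

theorem den_cast_pos (h : HasContinuedFraction x A Q P) (k : ℕ) : (0 : ℝ) < Q k := by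
  exact_mod_cast h.den_pos k

theorem abs_sub_le_self (h : HasContinuedFraction x A Q P) (k : ℕ) :
    |(Q k : ℝ) * x - P k| ≤ 1 / Q k :=
  (h.abs_sub_le k).trans (one_div_le_one_div_of_le (h.den_cast_pos k)
    (by exact_mod_cast h.den_succ_mono k))

theorem exists_den_le_lt (h : HasContinuedFraction x A Q P) {X : ℝ} (hX : 1 ≤ X) :
    ∃ k, (Q k : ℝ) ≤ X ∧ X < Q (k + 1) := by
  classical
  have hex : ∃ k, X < Q (k + 1) := by
    obtain ⟨k, hk⟩ := exists_nat_gt X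
    exact ⟨k, hk.trans_le (by exact_mod_cast (Nat.le_succ k).trans (h.le_den (k + 1)))⟩
  refine ⟨Nat.find hex, ?_, Nat.find_spec hex⟩
  rcases Nat.eq_zero_or_pos (Nat.find hex) with h0 | h0
  · rw [h0, h.den_zero]; simpa using hX
  · have := Nat.find_min hex (m := Nat.find hex - 1) (by omega)
    rw [Nat.sub_add_cancel h0] at this
    exact not_lt.1 this

end HasContinuedFraction

theorem exists_hasContinuedFraction {x : ℝ} (hx : Irrational x) :
    ∃ (A Q : ℕ → ℕ) (P : ℕ → ℤ), HasContinuedFraction x A Q P := by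
  have hterm : ∀ k, ¬ (GenContFract.of x).TerminatedAt k := fun k hk => by
    obtain ⟨q, hq⟩ := (GenContFract.terminates_iff_rat x).1 ⟨k, hk⟩
    exact hx ⟨q, hq.symm⟩
  have hget : ∀ k, ∃ a : ℕ, 1 ≤ a ∧ (GenContFract.of x).s.get? k = some ⟨1, (a : ℝ)⟩ := by
    intro k
    obtain ⟨gp, hgp⟩ := Option.ne_none_iff_exists'.1 (hterm k)
    obtain ⟨h1, z, hz⟩ := GenContFract.of_partNum_eq_one_and_exists_int_partDen_eq hgp
    have h2 := GenContFract.of_one_le_get?_partDen (GenContFract.partDen_eq_s_b hgp)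
    rw [hz] at h2
    have h3 : 1 ≤ z := by exact_mod_cast h2
    refine ⟨z.toNat, by omega, ?_⟩
    have h4 : ((z.toNat : ℕ) : ℝ) = z := by exact_mod_cast Int.toNat_of_nonneg (by omega)
    rw [hgp, h4, ← h1, ← hz]
  choose A hA1 hA using hget
  have hden0 : (GenContFract.of x).dens 0 = 1 := GenContFract.zeroth_den_eq_one
  have hden1 : (GenContFract.of x).dens 1 = A 0 := GenContFract.first_den_eq (hA 0)
  have hden2 : ∀ k, (GenContFract.of x).dens (k + 2) =
      A (k + 1) * (GenContFract.of x).dens (k + 1) + (GenContFract.of x).dens k := fun k => by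
    rw [GenContFract.dens_recurrence (hA (k + 1)) rfl rfl, one_mul]
  have hnum2 : ∀ k, (GenContFract.of x).nums (k + 2) =
      A (k + 1) * (GenContFract.of x).nums (k + 1) + (GenContFract.of x).nums k := fun k => by
    rw [GenContFract.nums_recurrence (hA (k + 1)) rfl rfl, one_mul]
  have hQ : ∀ k, ∃ Q : ℕ, (GenContFract.of x).dens k = Q := by
    intro k
    induction k using Nat.twoStepInduction with
    | zero => exact ⟨1, by simp⟩
    | one => exact ⟨A 0, hden1⟩
    | more k ih1 ih2 =>
      obtain ⟨q, hq⟩ := ih1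
      obtain ⟨q', hq'⟩ := ih2
      exact ⟨A (k + 1) * q' + q, by rw [hden2, hq, hq']; push_cast; ring⟩
  have hP : ∀ k, ∃ P : ℤ, (GenContFract.of x).nums k = P := by
    intro k
    induction k using Nat.twoStepInduction with
    | zero => exact ⟨⌊x⌋, by rw [GenContFract.zeroth_num_eq_h, GenContFract.of_h_eq_floor]⟩
    | one =>
      refine ⟨A 0 * ⌊x⌋ + 1, ?_⟩
      rw [GenContFract.first_num_eq (hA 0), GenContFract.of_h_eq_floor]; push_cast; ring
    | more k ih1 ih2 =>
      obtain ⟨q, hq⟩ := ih1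
      obtain ⟨q', hq'⟩ := ih2
      exact ⟨A (k + 1) * q' + q, by rw [hnum2, hq, hq']; push_cast; ring⟩
  choose Q hQ using hQ
  choose P hP using hP
  have hQpos : ∀ k, (0 : ℝ) < Q k := by
    intro k
    induction k using Nat.twoStepInduction with
    | zero => rw [← hQ, hden0]; exact one_pos
    | one => rw [← hQ, hden1]; exact_mod_cast hA1 0
    | more k ih1 ih2 => rw [← hQ, hden2, hQ, hQ]; positivity
  refine ⟨A, Q, P, hx, fun k => ?_, hQ, hA1, ?_, ?_, fun k => ?_, fun k => ?_, fun k => ?_⟩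
  · rw [partialQuotient, GenContFract.partDen_eq_s_b (hA k), Option.getD_some]
  · exact_mod_cast (hQ 0).symm.trans hden0
  · exact_mod_cast (hQ 1).symm.trans hden1
  · have := hden2 k
    rw [hQ, hQ, hQ] at this
    exact_mod_cast this
  -- The determinant of consecutive convergents is `±1`, a Bézout relation for `P k` and `Q k`.
  · have h := SimpContFract.determinant (s := SimpContFract.of x) (n := k) (hterm k)
    have h' : (P k : ℝ) * Q (k + 1) - Q k * P (k + 1) = (-1) ^ (k + 1) := by
      rw [← hP, ← hQ, ← hQ, ← hP]; exact h
    have h2 : P k * Q (k + 1) - Q k * P (k + 1) = (-1) ^ (k + 1) := by exact_mod_cast h'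
    rcases neg_one_pow_eq_or ℤ (k + 1) with h3 | h3
    · exact ⟨Q (k + 1), -P (k + 1), by rw [h3] at h2; linarith⟩
    · exact ⟨-Q (k + 1), P (k + 1), by rw [h3] at h2; linarith⟩
  · have h := GenContFract.abs_sub_convs_le (hterm k)
    rw [GenContFract.conv_eq_num_div_den, hP, hQ, hQ] at h
    have h1 := hQpos k
    have h2 := hQpos (k + 1)
    calc |(Q k : ℝ) * x - P k| = Q k * |x - P k / Q k| := by
          rw [← abs_of_pos h1, ← abs_mul, abs_of_pos h1, mul_sub, mul_div_cancel₀ _ h1.ne']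
      _ ≤ Q k * (1 / (Q k * Q (k + 1))) := by gcongr
      _ = _ := by field_simp

/-- Every sequence of positive integers is the sequence of partial quotients of an irrational
number. -/
theorem exists_partialQuotient_eq (A : ℕ → ℕ) (hA : ∀ k, 1 ≤ A k) :
    ∃ x : ℝ, Irrational x ∧ ∀ k, partialQuotient x (k + 1) = A k := by
  have hA' : ∀ k, (1 : ℝ) ≤ A k := fun k => by exact_mod_cast hA k
  -- Finite continued fractions: `w j k` uses the `j` quotients starting at `A k`.
  set w : ℕ → ℕ → ℝ := fun j => Nat.rec (fun _ => 0) (fun _ f k => 1 / (A k + f (k + 1))) j with hw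
  have hw0 : ∀ k, w 0 k = 0 := fun _ => rfl
  have hws : ∀ j k, w (j + 1) k = 1 / (A k + w j (k + 1)) := fun _ _ => rfl
  have hwI : ∀ j k, w j k ∈ Set.Icc (0 : ℝ) 1 := by
    intro j
    induction j with
    | zero => intro k; rw [hw0]; simp
    | succ j ih =>
      intro k
      have h1 := ih (k + 1)
      have h2 := hA' k
      have h3 : (1 : ℝ) ≤ A k + w j (k + 1) := by linarith [h1.1]
      rw [hws]
      exact ⟨by positivity, by rw [div_le_one (by linarith)]; exact h3⟩
  -- Sequences in `[0,1]^ℕ` satisfying the first `N` tail equations `t k (A k + t (k+1)) = 1`. These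
  -- nested compact sets are nonempty by the finite continued fractions, and a common point lists
  -- all tails of the number sought.
  set C : ℕ → Set (ℕ → ℝ) := fun N => (Set.univ.pi fun _ => Set.Icc (0 : ℝ) 1) ∩
    ⋂ k ∈ Set.Iio N, {t | t k * (A k + t (k + 1)) = 1} with hC
  have hclosed : ∀ N, IsClosed (⋂ k ∈ Set.Iio N, {t : ℕ → ℝ | t k * (A k + t (k + 1)) = 1}) :=
    fun N => isClosed_biInter fun k _ => isClosed_eq (by fun_prop) continuous_const
  have hbox : IsCompact (Set.univ.pi fun _ : ℕ => Set.Icc (0 : ℝ) 1) :=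
    isCompact_univ_pi fun _ => isCompact_Icc
  obtain ⟨t, ht⟩ := IsCompact.nonempty_iInter_of_sequence_nonempty_isCompact_isClosed C
    (fun N => Set.inter_subset_inter_right _
      (Set.biInter_mono (fun k (hk : k < N) => Nat.lt_succ_of_lt hk) fun _ _ => subset_rfl))
    (fun N => by
      refine ⟨fun k => w (N - k) k, fun k _ => hwI _ _, Set.mem_iInter₂.2 fun k hk => ?_⟩
      have hk' : k < N := hk
      have e : N - k = (N - (k + 1)) + 1 := by omega
      have h2 := hA' k
      have h3 := (hwI (N - (k + 1)) (k + 1)).1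
      show w (N - k) k * (A k + w (N - (k + 1)) (k + 1)) = 1
      rw [e, hws]
      exact one_div_mul_cancel (by linarith))
    (hbox.inter_right (hclosed 0)) (fun N => hbox.isClosed.inter (hclosed N))
  have ht' : ∀ N, t ∈ C N := fun N => Set.mem_iInter.1 ht N
  have htI : ∀ k, t k ∈ Set.Icc (0 : ℝ) 1 := fun k => (ht' 0).1 k trivial
  have hteq : ∀ k, t k * (A k + t (k + 1)) = 1 := fun k =>
    Set.mem_iInter₂.1 (ht' (k + 1)).2 k (Nat.lt_succ_self k)
  have htpos : ∀ k, 0 < t k := fun k =>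
    (htI k).1.lt_of_ne fun h0 => by have := hteq k; rw [← h0, zero_mul] at this; norm_num at this
  have htinv : ∀ k, (t k)⁻¹ = A k + t (k + 1) := fun k => inv_eq_of_mul_eq_one_right (hteq k)
  have htlt : ∀ k, t k < 1 := fun k => by
    have h1 := hteq k; have h2 := htpos (k + 1); have h3 := hA' k; have h4 := htpos k
    nlinarith
  have hfloor : ∀ k, ⌊(t k)⁻¹⌋ = A k := fun k => by
    rw [htinv, Int.floor_eq_iff]
    push_cast
    exact ⟨by linarith [htpos (k + 1)], by linarith [htlt (k + 1)]⟩
  have hfract : ∀ k, Int.fract (t k)⁻¹ = t (k + 1) := fun k => by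
    rw [Int.fract, hfloor, htinv]; push_cast; ring
  have hget : ∀ k j (v : ℝ), Int.fract v = t j →
      (GenContFract.of v).s.get? k = some ⟨1, (A (j + k) : ℝ)⟩ := by
    intro k
    induction k with
    | zero =>
      intro j v hv
      have h1 := GenContFract.of_s_head (v := v) (by rw [hv]; exact (htpos j).ne')
      rw [hv, hfloor, Int.cast_natCast] at h1
      exact h1
    | succ k ih =>
      intro j v hv
      rw [GenContFract.of_s_succ, hv, ih (j + 1) _ (hfract j)]
      congr 3
      rw [add_right_comm]; rfl
  have h0 : ∀ k, (GenContFract.of (t 0)).s.get? k = some ⟨1, (A k : ℝ)⟩ := fun k => by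
    simpa using hget k 0 (t 0) (Int.fract_eq_self.2 ⟨(htpos 0).le, htlt 0⟩)
  refine ⟨t 0, ?_, fun k => ?_⟩
  · rintro ⟨q, hq⟩
    obtain ⟨k, hk⟩ := (GenContFract.terminates_iff_rat (t 0)).2 ⟨q, hq.symm⟩
    have hk' : (GenContFract.of (t 0)).s.get? k = none := hk
    rw [h0] at hk'
    exact absurd hk' (by simp)
  · rw [partialQuotient, GenContFract.partDen_eq_s_b (h0 k), Option.getD_some]

/-- A number whose partial quotients are prescribed recursively in terms of the continuants. -/
theorem exists_hasContinuedFraction_rec (a₀ : ℕ) (ha₀ : 1 ≤ a₀) (F : ℕ → ℕ → ℕ → ℕ)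
    (hF : ∀ k u v, 1 ≤ v → 1 ≤ F k u v) :
    ∃ (x : ℝ) (A Q : ℕ → ℕ) (P : ℕ → ℤ), HasContinuedFraction x A Q P ∧ A 0 = a₀ ∧
      ∀ k, A (k + 1) = F k (Q k) (Q (k + 1)) := by
  -- The state is the pair `(Q k, Q (k + 1))`, on which the next quotient depends.
  set s : ℕ → ℕ × ℕ := fun k => Nat.rec (1, a₀) (fun k p => (p.2, F k p.1 p.2 * p.2 + p.1)) k
    with hs
  have hss : ∀ k, s (k + 1) = ((s k).2, F k (s k).1 (s k).2 * (s k).2 + (s k).1) := fun _ => rfl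
  have hpos : ∀ k, 1 ≤ (s k).1 ∧ 1 ≤ (s k).2 := by
    intro k
    induction k with
    | zero => exact ⟨le_rfl, ha₀⟩
    | succ k ih => rw [hss]; exact ⟨ih.2, by dsimp only; omega⟩
  obtain ⟨x, hx, hxA⟩ := exists_partialQuotient_eq
    (fun k => Nat.casesOn k a₀ fun k => F k (s k).1 (s k).2) (fun k => by
      cases k with
      | zero => exact ha₀
      | succ k => exact hF _ _ _ (hpos k).2)
  obtain ⟨A, Q, P, h⟩ := exists_hasContinuedFraction hx
  have hA0 : A 0 = a₀ := by exact_mod_cast (h.partialQuotient_eq 0).symm.trans (hxA 0)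
  have hA1 : ∀ k, A (k + 1) = F k (s k).1 (s k).2 := fun k => by
    exact_mod_cast (h.partialQuotient_eq (k + 1)).symm.trans (hxA (k + 1))
  have hQ : ∀ k, Q k = (s k).1 ∧ Q (k + 1) = (s k).2 := by
    intro k
    induction k with
    | zero => exact ⟨h.den_zero, h.den_one.trans hA0⟩
    | succ k ih => rw [hss, h.den_add_two, hA1, ih.1, ih.2]; exact ⟨rfl, rfl⟩
  exact ⟨x, A, Q, P, h, hA0, fun k => by rw [hA1, (hQ k).1, (hQ k).2]⟩

/-! ### One-dimensional approximation -/

theorem mem_approximableOne {x σ : ℝ}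
    (h : ∀ m : ℕ, ∃ q : ℕ, m ≤ q ∧ 1 ≤ q ∧ ∃ p : ℤ, |(q : ℝ) * x - p| < (q : ℝ) ^ (-σ)) :
    x ∈ approximableOne σ := by
  intro hfin
  obtain ⟨B, hB⟩ := (hfin.image Prod.snd).bddAbove
  obtain ⟨q, hq, hq1, p, hp⟩ := h (B + 1)
  have : q ≤ B := by
    refine hB ⟨(fun _ => p, q), ⟨hq1, ?_⟩, rfl⟩
    rw [pi_norm_lt_iff ((abs_nonneg _).trans_lt hp)]
    exact fun _ => hp
  omega

theorem exists_forall_le_of_notMem_approximableOne {x σ : ℝ} (h : x ∉ approximableOne σ) :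
    ∃ m : ℕ, ∀ q : ℕ, m ≤ q → 1 ≤ q → ∀ p : ℤ, (q : ℝ) ^ (-σ) ≤ |(q : ℝ) * x - p| := by
  by_contra! hcon
  exact h (mem_approximableOne hcon)

theorem notMem_approximableOne {x σ : ℝ} (hσ : 0 ≤ σ) {m : ℕ}
    (h : ∀ q : ℕ, m ≤ q → 1 ≤ q → ∀ p : ℤ, (q : ℝ) ^ (-σ) ≤ |(q : ℝ) * x - p|) :
    x ∉ approximableOne σ := by
  refine Set.not_infinite.2 (Set.Finite.subset (((Finset.range m).finite_toSet.biUnion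
    fun q _ => (((Fintype.piFinset fun _ : Fin 1 =>
      Finset.Icc ⌈(q : ℝ) * x - 1⌉ ⌊(q : ℝ) * x + 1⌋).finite_toSet).prod
        (Set.finite_singleton q)))) ?_)
  rintro ⟨p, q⟩ ⟨hq1, hp⟩
  have hq0 : (1 : ℝ) ≤ q := by exact_mod_cast hq1
  dsimp only at hp hq1
  have hi : ∀ i, |(q : ℝ) * x - p i| < (q : ℝ) ^ (-σ) := by
    rw [pi_norm_lt_iff ((norm_nonneg _).trans_lt hp)] at hp
    exact hp
  have hqm : q < m := by
    by_contra hqm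
    exact absurd (hi 0) (not_lt.2 (h q (not_lt.1 hqm) hq1 (p 0)))
  refine Set.mem_biUnion (x := q) (by simpa using hqm) ⟨?_, rfl⟩
  rw [Finset.mem_coe, Fintype.mem_piFinset]
  intro i
  have h1 := abs_lt.1 ((hi i).trans_le (Real.rpow_le_one_of_one_le_of_nonpos hq0 (by linarith)))
  rw [Finset.mem_Icc, Int.ceil_le, Int.le_floor]
  constructor <;> linarith [h1.1, h1.2]

theorem approximableOne_anti {σ τ : ℝ} (hστ : σ ≤ τ) : approximableOne τ ⊆ approximableOne σ := by
  intro x hx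
  refine Set.Infinite.mono ?_ hx
  rintro ⟨p, q⟩ ⟨hq1, hp⟩
  have hq0 : (1 : ℝ) ≤ q := by exact_mod_cast hq1
  exact ⟨hq1, hp.trans_le (Real.rpow_le_rpow_of_exponent_le hq0 (by linarith))⟩

theorem irrational_of_notMem_approximableOne {x σ : ℝ} (h : x ∉ approximableOne σ) :
    Irrational x := by
  rintro ⟨r, rfl⟩
  refine h (mem_approximableOne fun m => ⟨(m + 1) * r.den, ?_, ?_, (m + 1) * r.num, ?_⟩)
  · calc m ≤ (m + 1) * 1 := by omega
      _ ≤ _ := Nat.mul_le_mul_left _ r.den_pos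
  · exact Nat.mul_pos (by omega) r.den_pos
  · have h0 : (((m + 1) * r.den : ℕ) : ℝ) * (r : ℝ) - (((m + 1) * r.num : ℤ) : ℝ) = 0 := by
      have h2 : (r : ℝ) = r.num / r.den := Rat.cast_def r
      have h3 : (r.den : ℝ) ≠ 0 := by exact_mod_cast r.den_nz
      rw [h2]; push_cast; field_simp; ring
    rw [h0, abs_zero]
    have : (0 : ℝ) < ((m + 1) * r.den : ℕ) := by
      exact_mod_cast Nat.mul_pos (by omega) r.den_pos
    positivity

/-! ### Quadratic growth of continuants and positive density -/

namespace HasContinuedFraction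

variable {x : ℝ} {A Q : ℕ → ℕ} {P : ℕ → ℤ}

theorem mem_largeIndices_iff (h : HasContinuedFraction x A Q P) {R : ℝ} {k : ℕ} :
    k ∈ largeIndices x R ↔ R < A k := by
  rw [← h.partialQuotient_eq]; rfl

theorem eventually_den_succ_le_rpow (h : HasContinuedFraction x A Q P) {σ : ℝ}
    (hx : x ∉ approximableOne σ) : ∃ k₀, ∀ k, k₀ ≤ k → (Q (k + 1) : ℝ) ≤ (Q k : ℝ) ^ σ := by
  obtain ⟨m, hm⟩ := exists_forall_le_of_notMem_approximableOne hx
  refine ⟨m, fun k hk => ?_⟩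
  have h1 := (hm (Q k) (hk.trans (h.le_den k)) (h.den_pos k) (P k)).trans (h.abs_sub_le k)
  have h2 := h.den_cast_pos k
  have h3 := h.den_cast_pos (k + 1)
  rw [Real.rpow_neg h2.le, ← one_div, one_div_le_one_div (by positivity) h3] at h1
  exact h1

/-- If the continuants grow at most quadratically, almost every point of the fiber is
approximable. -/
theorem fullFiber (h : HasContinuedFraction x A Q P) {C : ℝ} {k₀ : ℕ}
    (hC : ∀ k, k₀ ≤ k → (Q (k + 1) : ℝ) ≤ C * (Q k : ℝ) ^ 2) {n : ℕ} (hn : 2 ≤ n) {ψ : ℕ → ℝ}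
    (hψ : IsApproximatingFunction ψ) (hdiv : ¬ Summable fun q : ℕ => ψ q ^ (n + 1)) :
    FullFiber n ψ x := by
  obtain ⟨φ, hφ0, hanti, hφ1, hφψ, hdiv'⟩ := exists_truncation hn hψ hdiv
  set ε : ℝ := 1 / (120 * 10 ^ n) with hε
  have hε0 : 0 < ε := by positivity
  -- The summand `Q k₀` takes care of the indices below `k₀`, for which `Q (k + 1) ≤ Q k₀`.
  have hC' : ∀ k, (Q (k + 1) : ℝ) ≤ (|C| + Q k₀) * (Q k : ℝ) ^ 2 := by
    intro k
    have h1 : (1 : ℝ) ≤ (Q k : ℝ) ^ 2 := one_le_pow₀ (by exact_mod_cast h.den_pos k)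
    have h2 := abs_nonneg C
    have h3 := h.den_cast_pos k₀
    rcases le_or_gt k₀ k with hk | hk
    · have h4 := le_abs_self C
      nlinarith [hC k hk]
    · have h4 : (Q (k + 1) : ℝ) ≤ Q k₀ := by exact_mod_cast h.den_mono hk
      nlinarith
  obtain ⟨k₁, hk₁⟩ := pow_unbounded_of_one_lt (1 / ε) one_lt_two
  refine fullFiber_of_sq_ge (by omega) hε0 (mul_one_div_cancel (by positivity)).le hψ hφ0 hanti hφ1
    hφψ (not_summable_indicator_inter_Ici hdiv' k₁) (fun k hk => hk.1)
    (C := |C| + Q k₀) (add_pos_of_nonneg_of_pos (abs_nonneg C) (h.den_cast_pos k₀)) fun k hk => ?_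
  have hX : 1 ≤ ε * 2 ^ k := by
    rw [div_lt_iff₀ hε0] at hk₁
    have : (2 : ℝ) ^ k₁ ≤ 2 ^ k := pow_le_pow_right₀ one_le_two hk.2
    nlinarith
  -- The last continuant `Q j ≤ ε 2^k` serves as `b`: the next one exceeds `ε 2^k` and is at most a
  -- constant times `Q j ^ 2`.
  obtain ⟨j, hj1, hj2⟩ := h.exists_den_le_lt hX
  exact ⟨P j, Q j, h.den_pos j, h.coprime j, h.abs_sub_le_self j, hj1, hj2.le.trans (hC' j)⟩

/-- Continuants at least double every two steps, so the squares at least quadruple along each parity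
class. -/
theorem sum_den_sq_le (h : HasContinuedFraction x A Q P) (k : ℕ) :
    ∑ i ∈ Finset.range (k + 1), Q i ^ 2 ≤ 3 * Q k ^ 2 := by
  induction k using Nat.twoStepInduction with
  | zero => simp; omega
  | one =>
    rw [Finset.sum_range_succ, Finset.sum_range_one, h.den_zero]
    have := Nat.pow_le_pow_left (h.den_pos 1) 2
    omega
  | more k ih _ =>
    rw [Finset.sum_range_succ, Finset.sum_range_succ]
    have h1 := Nat.pow_le_pow_left (h.den_succ_mono (k + 1)) 2
    have h2 := Nat.pow_le_pow_left (h.two_mul_den_le k) 2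
    rw [mul_pow] at h2
    have h3 : k + 1 + 1 = k + 2 := rfl
    rw [h3] at h1 ⊢
    omega

theorem block_eq (h : HasContinuedFraction x A Q P) (R : ℝ) (m : ℕ) :
    block x R m = Finset.Icc (blockMin x R m) (Q (largeIndex x R m)) := by
  rw [block, h.continuant_eq, Nat.floor_natCast]

theorem blockMin_succ (h : HasContinuedFraction x A Q P) (R : ℝ) (m : ℕ) :
    blockMin x R (m + 1) =
      ⌈(Q (largeIndex x R m + 1) : ℝ) - R * Q (largeIndex x R m)⌉₊ := by
  rw [blockMin, h.continuant_eq, h.continuant_eq]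

end HasContinuedFraction

/-- The top `h + 1` terms are each at least `q - h ≥ q/2`. -/
theorem sum_Icc_ge {lo q h : ℕ} (hq : 2 * h ≤ q) (hlo : lo ≤ q - h) :
    (2 * h + 2) * q ≤ 4 * ∑ L ∈ Finset.Icc lo q, L := by
  have h1 : (Finset.Icc (q - h) q).card • (q - h) ≤ ∑ L ∈ Finset.Icc (q - h) q, L :=
    Finset.card_nsmul_le_sum _ _ _ fun L hL => (Finset.mem_Icc.1 hL).1
  have h2 : ∑ L ∈ Finset.Icc (q - h) q, L ≤ ∑ L ∈ Finset.Icc lo q, L :=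
    Finset.sum_le_sum_of_subset (Finset.Icc_subset_Icc_left hlo)
  rw [Nat.card_Icc, smul_eq_mul, show q + 1 - (q - h) = h + 1 by omega] at h1
  have h3 : q ≤ 2 * (q - h) := by omega
  nlinarith

theorem largeIndex_strictMono {x R : ℝ} (hinf : (largeIndices x R).Infinite) :
    StrictMono (largeIndex x R) := Nat.nth_strictMono hinf

theorem largeIndex_mem {x R : ℝ} (hinf : (largeIndices x R).Infinite) (m : ℕ) :
    largeIndex x R m ∈ largeIndices x R := Nat.nth_mem_of_infinite hinf m

theorem exists_largeIndex_eq {x R : ℝ} (hinf : (largeIndices x R).Infinite) {k : ℕ}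
    (hk : k ∈ largeIndices x R) : ∃ m, largeIndex x R m = k := by
  have := Nat.range_nth_of_infinite hinf
  rw [Set.ext_iff] at this
  exact (this k).2 hk

theorem notMem_largeIndices_between {x R : ℝ} (hinf : (largeIndices x R).Infinite) {m l : ℕ}
    (h1 : largeIndex x R m < l) (h2 : l < largeIndex x R (m + 1)) : l ∉ largeIndices x R := by
  intro hl
  obtain ⟨i, rfl⟩ := exists_largeIndex_eq hinf hl
  rw [(largeIndex_strictMono hinf).lt_iff_lt] at h1 h2
  omega

/-- At a large index `k`, the limsup condition bounds the next block minimum, which is at least `Q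
(k+1) - R Q k`, by a multiple of the sum of all earlier blocks; each block sums to at most the
square of its last continuant, so that sum is at most `3 (Q k)²`. At other indices the quotient is
at most `R` and growth is linear. -/
theorem HasContinuedFraction.exists_den_succ_le_of_positiveDensityProperty {x : ℝ} {A Q : ℕ → ℕ}
    {P : ℕ → ℤ} (h : HasContinuedFraction x A Q P) (hx : PositiveDensityProperty x) :
    ∃ (C : ℝ) (k₀ : ℕ), ∀ k, k₀ ≤ k → (Q (k + 1) : ℝ) ≤ C * (Q k : ℝ) ^ 2 := by
  obtain ⟨-, R, hR, hlim⟩ := hx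
  have hQ1 : ∀ k, (1 : ℝ) ≤ Q k := fun k => by exact_mod_cast h.den_pos k
  have hsmall : ∀ k, k ∉ largeIndices x R → (Q (k + 1) : ℝ) ≤ (R + 1) * (Q k : ℝ) ^ 2 := by
    intro k hk
    rw [h.mem_largeIndices_iff, not_lt] at hk
    have h1 : (Q (k + 1) : ℝ) ≤ (A k + 1) * Q k := by exact_mod_cast h.den_succ_le k
    have h2 := hQ1 k
    calc (Q (k + 1) : ℝ) ≤ (A k + 1) * Q k := h1
      _ ≤ (R + 1) * Q k := by gcongr
      _ ≤ (R + 1) * (Q k : ℝ) ^ 2 := by gcongr; exact le_self_pow₀ h2 two_ne_zero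
  by_cases hfin : (largeIndices x R).Finite
  · obtain ⟨B, hB⟩ := hfin.bddAbove
    exact ⟨R + 1, B + 1, fun k hk => hsmall k fun hk' => by have := hB hk'; omega⟩
  have hlim := hlim.resolve_left hfin
  have hinf : (largeIndices x R).Infinite := hfin
  have hle : ∀ m, blockMin x R m ≤ sumToBlockMin x R m := fun m => Nat.le_add_left _ _
  have hratio : ∀ m, (blockMin x R m : ℝ) / sumToBlockMin x R m ≤ 1 := fun m =>
    div_le_one_of_le₀ (by exact_mod_cast hle m) (Nat.cast_nonneg _)
  obtain ⟨θ, hθ1, hθ2⟩ := exists_between hlim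
  have hev := Filter.eventually_lt_of_limsup_lt hθ1
    (Filter.isBoundedUnder_of ⟨1, hratio⟩)
  obtain ⟨m₀, hm₀⟩ := Filter.eventually_atTop.1 hev
  have hθ0 : 0 < 1 - θ := by linarith
  refine ⟨R + 1 + 3 / (1 - θ), largeIndex x R m₀, fun k hk => ?_⟩
  by_cases hkL : k ∈ largeIndices x R
  swap
  · have : 0 < 3 / (1 - θ) := by positivity
    exact (hsmall k hkL).trans (mul_le_mul_of_nonneg_right (by linarith) (by positivity))
  obtain ⟨m, rfl⟩ := exists_largeIndex_eq hinf hkL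
  have hm : m₀ ≤ m := (largeIndex_strictMono hinf).le_iff_le.1 hk
  have hlt := hm₀ (m + 1) (by omega)
  set b : ℝ := (blockMin x R (m + 1) : ℝ) with hb
  set S : ℕ := ∑ j ∈ Finset.range (m + 1), ∑ L ∈ block x R j, L with hS
  have hsum : (sumToBlockMin x R (m + 1) : ℝ) = S + b := by rw [sumToBlockMin, Nat.cast_add]
  have hb0 : 0 ≤ b := Nat.cast_nonneg _
  have hS0 : (0 : ℝ) ≤ S := Nat.cast_nonneg _
  have hbS : (1 - θ) * b ≤ S := by
    rw [hsum] at hlt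
    rcases (add_nonneg hS0 hb0).eq_or_lt with h0 | h0
    · have : b = 0 := by linarith
      rw [this, mul_zero]; exact hS0
    · rw [div_lt_iff₀ h0] at hlt
      nlinarith
  set k := largeIndex x R m with hkdef
  have hSle : S ≤ 3 * Q k ^ 2 := by
    calc S ≤ ∑ j ∈ Finset.range (m + 1), Q (largeIndex x R j) ^ 2 := by
          refine Finset.sum_le_sum fun j _ => ?_
          rw [h.block_eq]
          calc ∑ L ∈ Finset.Icc (blockMin x R j) (Q (largeIndex x R j)), L
              ≤ ∑ L ∈ Finset.range (Q (largeIndex x R j) + 1), L :=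
                Finset.sum_le_sum_of_subset fun L hL => by
                  have := (Finset.mem_Icc.1 hL).2
                  exact Finset.mem_range.2 (by omega)
            _ ≤ Q (largeIndex x R j) ^ 2 := by
                rw [Finset.sum_range_id]
                refine Nat.div_le_of_le_mul ?_
                have := h.den_pos (largeIndex x R j)
                rw [Nat.add_sub_cancel, sq]
                nlinarith
      _ = ∑ i ∈ (Finset.range (m + 1)).image (largeIndex x R), Q i ^ 2 := by
          rw [Finset.sum_image fun a _ b _ hab => (largeIndex_strictMono hinf).injective hab]
      _ ≤ ∑ i ∈ Finset.range (k + 1), Q i ^ 2 := by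
          refine Finset.sum_le_sum_of_subset fun i hi => ?_
          obtain ⟨j, hj, rfl⟩ := Finset.mem_image.1 hi
          have := (largeIndex_strictMono hinf).monotone (Nat.lt_succ_iff.1 (Finset.mem_range.1 hj))
          exact Finset.mem_range.2 (Nat.lt_succ_of_le this)
      _ ≤ _ := h.sum_den_sq_le k
  have hSle' : (S : ℝ) ≤ 3 * (Q k : ℝ) ^ 2 := by exact_mod_cast hSle
  have hceil : (Q (k + 1) : ℝ) - R * Q k ≤ b := by
    rw [hb, h.blockMin_succ]; exact Nat.le_ceil _
  have hb2 : b ≤ 3 / (1 - θ) * (Q k : ℝ) ^ 2 := by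
    rw [div_mul_eq_mul_div, le_div_iff₀ hθ0]; linarith
  have hq2 : (Q k : ℝ) ≤ (Q k : ℝ) ^ 2 := le_self_pow₀ (hQ1 k) two_ne_zero
  nlinarith [hQ1 k]

/-- The most recent block alone can witness the property: if it outweighs the next minimum up to a
factor `C`, the ratio is at most `C/(C+1)`. -/
theorem positiveDensityProperty_of_blockMin_le {x R C : ℝ} (hx : Irrational x) (hR : 1 ≤ R)
    (hC : 0 < C) (h : (largeIndices x R).Infinite → ∃ m₀, ∀ m, m₀ ≤ m →
      (blockMin x R (m + 1) : ℝ) ≤ C * ((∑ L ∈ block x R m, L : ℕ) : ℝ)) :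
    PositiveDensityProperty x := by
  refine ⟨hx, R, hR, ?_⟩
  by_cases hfin : (largeIndices x R).Finite
  · exact Or.inl hfin
  obtain ⟨m₀, hm₀⟩ := h hfin
  right
  have hbound : ∀ m, m₀ + 1 ≤ m →
      (blockMin x R m : ℝ) / (sumToBlockMin x R m : ℝ) ≤ C / (C + 1) := by
    intro m hm
    obtain ⟨m, rfl⟩ : ∃ i, m = i + 1 := ⟨m - 1, by omega⟩
    have h1 := hm₀ m (by omega)
    have h2 : ∑ L ∈ block x R m, L + blockMin x R (m + 1) ≤ sumToBlockMin x R (m + 1) := by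
      rw [sumToBlockMin, Finset.sum_range_succ]; omega
    have h3 : ((∑ L ∈ block x R m, L : ℕ) : ℝ) + blockMin x R (m + 1) ≤
        sumToBlockMin x R (m + 1) := by exact_mod_cast h2
    refine div_le_of_le_mul₀ (Nat.cast_nonneg _) (by positivity) ?_
    rw [div_mul_eq_mul_div, le_div_iff₀ (by positivity)]
    nlinarith
  refine lt_of_le_of_lt (Filter.limsup_le_of_le ?_ (Filter.eventually_atTop.2 ⟨_, hbound⟩)) ?_
  · exact Filter.isCoboundedUnder_le_of_le _ (x := 0) fun m => by positivity
  · rw [div_lt_one (by positivity)]; linarith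

/-! ### Sufficient conditions for positive density -/

namespace HasContinuedFraction

variable {x : ℝ} {A Q : ℕ → ℕ} {P : ℕ → ℤ}

theorem blockMin_succ_le (h : HasContinuedFraction x A Q P) {R : ℝ} (hR : 1 ≤ R) (m : ℕ) :
    blockMin x R (m + 1) ≤ Q (largeIndex x R m + 1) := by
  rw [h.blockMin_succ, Nat.ceil_le]
  have : 0 ≤ R * Q (largeIndex x R m) := by positivity
  linarith

/-- Even without doubling, subtracting `R Q k` in the block minimum leaves about `Q k / 2` integers
just below `Q k'` in the block, where `k < k'` are the two consecutive large indices. -/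
theorem den_mul_den_le_sum_block (h : HasContinuedFraction x A Q P) {R : ℝ} (hR : 1 ≤ R)
    (hinf : (largeIndices x R).Infinite) (m : ℕ) :
    Q (largeIndex x R m) * Q (largeIndex x R (m + 1)) ≤ 4 * ∑ L ∈ block x R (m + 1), L := by
  have hlt : largeIndex x R m < largeIndex x R (m + 1) := largeIndex_strictMono hinf (by omega)
  rw [h.block_eq]
  set k := largeIndex x R m with hk
  set k' := largeIndex x R (m + 1) with hk'
  have h1 : Q (k + 1) ≤ Q k' := h.den_mono hlt
  have h2 : Q k ≤ Q (k + 1) := h.den_succ_mono k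
  refine le_trans ?_ (sum_Icc_ge (h := Q k / 2) (by omega) ?_)
  · exact Nat.mul_le_mul_right _ (by omega)
  · rw [h.blockMin_succ, Nat.ceil_le, Nat.cast_sub (by omega)]
    have h3 : ((Q k / 2 : ℕ) : ℝ) ≤ Q k := by exact_mod_cast Nat.div_le_self _ _
    have h4 : (Q (k + 1) : ℝ) ≤ Q k' := by exact_mod_cast h1
    have h5 := h.den_cast_pos k
    nlinarith

/-- Under doubling the block contains the whole upper half of `[0, q]`, `q` being its last element.
-/
theorem den_sq_le_sum_block (h : HasContinuedFraction x A Q P) {R : ℝ} (hR : 1 ≤ R) {m : ℕ}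
    (hdouble : 2 * Q (largeIndex x R m + 1) ≤ Q (largeIndex x R (m + 1))) :
    Q (largeIndex x R (m + 1)) ^ 2 ≤ 4 * ∑ L ∈ block x R (m + 1), L := by
  rw [h.block_eq]
  refine le_trans ?_ (sum_Icc_ge (h := Q (largeIndex x R (m + 1)) / 2) (by omega) ?_)
  · rw [sq]; exact Nat.mul_le_mul_right _ (by omega)
  · exact (h.blockMin_succ_le hR m).trans (by omega)

theorem positiveDensityProperty_of_double (h : HasContinuedFraction x A Q P) {R C : ℝ}
    (hR : 1 ≤ R) (hC : 0 < C) {N : ℕ}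
    (hdouble : ∀ i j : ℕ, N ≤ i → i < j → i ∈ largeIndices x R → j ∈ largeIndices x R →
      (∀ l, i < l → l < j → l ∉ largeIndices x R) → 2 * Q (i + 1) ≤ Q j)
    (hle : ∀ k, N ≤ k → (Q (k + 1) : ℝ) ≤ C * (Q k : ℝ) ^ 2) : PositiveDensityProperty x := by
  refine positiveDensityProperty_of_blockMin_le (C := C * 4) h.irrational hR (by positivity)
    fun hinf => ⟨N + 1, fun m hm => ?_⟩
  obtain ⟨m, rfl⟩ : ∃ i, m = i + 1 := ⟨m - 1, by omega⟩
  have hmono := largeIndex_strictMono hinf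
  have hN : N ≤ largeIndex x R m := (by omega : N ≤ m).trans hmono.le_apply
  have hlt : largeIndex x R m < largeIndex x R (m + 1) := hmono (by omega)
  have h1 := h.den_sq_le_sum_block hR (hdouble _ _ hN hlt (largeIndex_mem hinf _)
    (largeIndex_mem hinf _) fun l => notMem_largeIndices_between hinf)
  have h2 : ((Q (largeIndex x R (m + 1)) : ℝ)) ^ 2 ≤
      4 * ((∑ L ∈ block x R (m + 1), L : ℕ) : ℝ) := by exact_mod_cast h1
  calc (blockMin x R (m + 1 + 1) : ℝ) ≤ Q (largeIndex x R (m + 1) + 1) := by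
        exact_mod_cast h.blockMin_succ_le hR (m + 1)
    _ ≤ C * (Q (largeIndex x R (m + 1)) : ℝ) ^ 2 := hle _ (by omega)
    _ ≤ C * (4 * ((∑ L ∈ block x R (m + 1), L : ℕ) : ℝ)) := by gcongr
    _ = _ := by ring

end HasContinuedFraction

/-- For consecutive large indices `k < k'`, write `γ` for the golden ratio; the next block minimum
is at most `Q(k'+1) ≤ Q(k')^γ`. If `Q(k') ≥ 2Q(k+1)`, the block sum is at least `Q(k')²/4`, which is
enough. Otherwise `Q(k') ≤ 2Q(k)^γ`, and since `γ(γ-1) = 1` this gives `Q(k')^(γ-1) ≤ 2Q(k)`, so the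
block sum bound `Q(k)Q(k')/4` is enough. The golden ratio is the exponent at which the second case
balances. -/
theorem positiveDensityProperty_of_notMem_goldenRatio {x : ℝ}
    (hx : x ∉ approximableOne Real.goldenRatio) : PositiveDensityProperty x := by
  have hirr := irrational_of_notMem_approximableOne hx
  obtain ⟨A, Q, P, h⟩ := exists_hasContinuedFraction hirr
  obtain ⟨k₀, hk₀⟩ := h.eventually_den_succ_le_rpow hx
  refine positiveDensityProperty_of_blockMin_le (R := 1) (C := 8) hirr le_rfl (by norm_num)
    fun hinf => ⟨k₀ + 1, fun m hm => ?_⟩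
  obtain ⟨m, rfl⟩ : ∃ i, m = i + 1 := ⟨m - 1, by omega⟩
  have hmono := largeIndex_strictMono hinf
  have hN : k₀ ≤ largeIndex x 1 m := (by omega : k₀ ≤ m).trans hmono.le_apply
  have hlt : largeIndex x 1 m < largeIndex x 1 (m + 1) := hmono (by omega)
  have h1 := h.den_mul_den_le_sum_block le_rfl hinf m
  have hmin : (blockMin x 1 (m + 1 + 1) : ℝ) ≤ Q (largeIndex x 1 (m + 1) + 1) := by
    exact_mod_cast h.blockMin_succ_le le_rfl (m + 1)
  have h2 := h.den_sq_le_sum_block (R := 1) le_rfl (m := m)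
  refine hmin.trans ((hk₀ _ (hN.trans hlt.le)).trans ?_)
  have hk₀' := hk₀ _ hN
  set k := largeIndex x 1 m
  set k' := largeIndex x 1 (m + 1)
  set S := ∑ L ∈ block x 1 (m + 1), L
  have hQ := h.den_cast_pos k
  have hQ1 : (1 : ℝ) ≤ Q k' := by exact_mod_cast h.den_pos k'
  have hφ2 : Real.goldenRatio < 2 := Real.goldenRatio_lt_two
  have hφ1 : 1 < Real.goldenRatio := Real.one_lt_goldenRatio
  have hsq : Real.goldenRatio ^ 2 = Real.goldenRatio + 1 := Real.goldenRatio_sq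
  have hS0 : (0 : ℝ) ≤ S := Nat.cast_nonneg _
  by_cases hd : 2 * Q (k + 1) ≤ Q k'
  · have h3 : (Q k' : ℝ) ^ 2 ≤ 4 * S := by exact_mod_cast h2 hd
    calc (Q k' : ℝ) ^ Real.goldenRatio ≤ (Q k' : ℝ) ^ (2 : ℝ) :=
          Real.rpow_le_rpow_of_exponent_le hQ1 hφ2.le
      _ = (Q k' : ℝ) ^ 2 := Real.rpow_two _
      _ ≤ 8 * S := by linarith
  · have h3 : (Q k' : ℝ) ≤ 2 * (Q k : ℝ) ^ Real.goldenRatio := by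
      have : (Q k' : ℝ) ≤ 2 * Q (k + 1) := by exact_mod_cast (not_le.1 hd).le
      linarith
    have h4 : (Q k' : ℝ) ^ (Real.goldenRatio - 1) ≤ 2 * Q k := by
      calc (Q k' : ℝ) ^ (Real.goldenRatio - 1)
          ≤ (2 * (Q k : ℝ) ^ Real.goldenRatio) ^ (Real.goldenRatio - 1) :=
            Real.rpow_le_rpow (by positivity) h3 (by linarith)
        _ = 2 ^ (Real.goldenRatio - 1) * (Q k : ℝ) := by
            rw [Real.mul_rpow (by norm_num) (by positivity), ← Real.rpow_mul hQ.le,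
              show Real.goldenRatio * (Real.goldenRatio - 1) = 1 by linarith, Real.rpow_one]
        _ ≤ 2 ^ (1 : ℝ) * (Q k : ℝ) := by
            gcongr
            · norm_num
            · linarith
        _ = _ := by rw [Real.rpow_one]
    have h5 : (Q k : ℝ) * Q k' ≤ 4 * S := by exact_mod_cast h1
    calc (Q k' : ℝ) ^ Real.goldenRatio = Q k' ^ (Real.goldenRatio - 1) * Q k' := by
          rw [← Real.rpow_add_one (by linarith)]; ring_nf
      _ ≤ 2 * Q k * Q k' := by gcongr
      _ ≤ 8 * S := by linarith

theorem positiveDensityProperty_of_continuantsDouble {x : ℝ} (hx : x ∉ approximableOne 2)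
    (hd : ContinuantsDouble x) : PositiveDensityProperty x := by
  obtain ⟨A, Q, P, h⟩ := exists_hasContinuedFraction (irrational_of_notMem_approximableOne hx)
  obtain ⟨k₀, hk₀⟩ := h.eventually_den_succ_le_rpow hx
  obtain ⟨R, hR, N, hN⟩ := hd
  refine h.positiveDensityProperty_of_double hR one_pos (N := max N k₀)
    (fun i j hi hij h1 h2 h3 => ?_) fun k hk => ?_
  · have := hN i j ((le_max_left _ _).trans hi) hij h1 h2 h3
    rw [h.continuant_eq, h.continuant_eq] at this
    exact_mod_cast this
  · rw [one_mul, ← Real.rpow_two]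
    exact hk₀ k ((le_max_right _ _).trans hk)

theorem exists_positiveDensityProperty_mem_approximableOne_two :
    ∃ x : ℝ, PositiveDensityProperty x ∧ x ∈ approximableOne 2 := by
  -- Taking `A k = Q k` at positive multiples of `3` and `1` elsewhere puts `Q (k+1)` between `Q k ^
  -- 2` and `2 (Q k)^2` at those multiples. Period `3` secures doubling: two unit quotients in
  -- between give `Q (i+3) = 2 Q (i+1) + Q i`.
  obtain ⟨x, A, Q, P, h, hA0, hA⟩ := exists_hasContinuedFraction_rec 1 le_rfl
    (fun k _ v => if 3 ∣ k + 1 then v else 1) (fun k _ v hv => by split_ifs; exacts [hv, le_rfl])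
  have hAdvd : ∀ k, 1 ≤ k → 3 ∣ k → A k = Q k := fun k hk hd => by
    obtain ⟨k, rfl⟩ : ∃ i, k = i + 1 := ⟨k - 1, by omega⟩
    rw [hA, if_pos hd]
  have hAnd : ∀ k, ¬ 3 ∣ k → A k = 1 := fun k hd => by
    obtain ⟨k, rfl⟩ : ∃ i, k = i + 1 := ⟨k - 1, by omega⟩
    rw [hA, if_neg hd]
  have hlarge : ∀ k, k ∈ largeIndices x 1 → 3 ∣ k := fun k hk => by
    by_contra hd
    rw [h.mem_largeIndices_iff, hAnd k hd] at hk
    simp at hk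
  have hAQ : ∀ k, A k ≤ Q k := fun k => by
    by_cases hd : 3 ∣ k
    · rcases Nat.eq_zero_or_pos k with rfl | hk
      · rw [hA0]; exact h.den_pos 0
      · exact (hAdvd k hk hd).le
    · rw [hAnd k hd]; exact h.den_pos k
  refine ⟨x, h.positiveDensityProperty_of_double (R := 1) (C := 2) (N := 0) le_rfl two_pos
    (fun i j _ hij hi hj _ => ?_) fun k _ => ?_, mem_approximableOne fun m => ?_⟩
  · have h1 := hlarge i hi
    have h2 := hlarge j hj
    have h3 : i + 3 ≤ j := by omega
    refine le_trans ?_ (h.den_mono h3)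
    have h4 := h.den_add_two (i + 1)
    have h5 := h.den_add_two i
    rw [hAnd (i + 1 + 1) (by omega), one_mul] at h4
    rw [hAnd (i + 1) (by omega), one_mul] at h5
    have h6 : i + 1 + 2 = i + 3 := rfl
    have h7 : i + 1 + 1 = i + 2 := rfl
    rw [h6, h7] at h4
    omega
  · have h1 : Q (k + 1) ≤ 2 * Q k ^ 2 := by
      refine (h.den_succ_le k).trans ?_
      have h2 := hAQ k
      have h3 := h.den_pos k
      rw [sq, ← mul_assoc]
      exact Nat.mul_le_mul_right _ (by omega)
    exact_mod_cast h1
  · refine ⟨Q (3 * m + 3), ?_, h.den_pos _, P (3 * m + 3), ?_⟩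
    · exact le_trans (by omega) (h.le_den (3 * m + 3))
    · refine (h.abs_sub_le _).trans_lt ?_
      have h1 := h.den_cast_pos (3 * m + 3)
      rw [Real.rpow_neg h1.le, ← one_div, Real.rpow_two]
      refine one_div_lt_one_div_of_lt (by positivity) ?_
      have h2 := h.den_add_two (3 * m + 2)
      rw [hAdvd (3 * m + 2 + 1) (by omega) (by omega)] at h2
      have h3 := h.den_pos (3 * m + 2)
      have h4 : Q (3 * m + 3) ^ 2 < Q (3 * m + 3 + 1) := by
        have e1 : 3 * m + 2 + 1 = 3 * m + 3 := rfl
        have e2 : 3 * m + 2 + 2 = 3 * m + 3 + 1 := rfl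
        rw [e1, e2] at h2
        rw [h2, sq]; omega
      exact_mod_cast h4

/-! ### Numbers of prescribed Diophantine type -/

/-- `x` has small partial quotients, encoding the set `b`, except that after the continuants cross
one of the thresholds `T m` a partial quotient of size `J` of the continuant is inserted. -/
structure IsJumpFraction (J T : ℕ → ℕ) (b : Set ℕ) (x : ℝ) (A Q : ℕ → ℕ) (P : ℕ → ℤ) : Prop
    extends HasContinuedFraction x A Q P where
  quotient_zero : A 0 = b.indicator 1 0 + 1
  quotient_of_jump : ∀ k, (∃ m, Q k < T m ∧ T m ≤ Q (k + 1)) →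
    A (k + 1) = b.indicator 1 (k + 1) + J (Q (k + 1))
  quotient_of_not_jump : ∀ k, (¬ ∃ m, Q k < T m ∧ T m ≤ Q (k + 1)) →
    A (k + 1) = b.indicator 1 (k + 1) + 1

theorem exists_isJumpFraction {J : ℕ → ℕ} (hJ : ∀ v, 1 ≤ v → 1 ≤ J v) (T : ℕ → ℕ) (b : Set ℕ) :
    ∃ (x : ℝ) (A Q : ℕ → ℕ) (P : ℕ → ℤ), IsJumpFraction J T b x A Q P := by
  classical
  obtain ⟨x, A, Q, P, h, hA0, hA⟩ := exists_hasContinuedFraction_rec (b.indicator 1 0 + 1)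
    (by omega) (fun k u v => b.indicator 1 (k + 1) + if ∃ m, u < T m ∧ T m ≤ v then J v else 1)
    (fun k u v hv => by
      have := hJ v hv
      split_ifs <;> omega)
  exact ⟨x, A, Q, P, h, hA0, fun k hk => by rw [hA, if_pos hk], fun k hk => by rw [hA, if_neg hk]⟩

theorem indicator_one_le_one (b : Set ℕ) (k : ℕ) : b.indicator (1 : ℕ → ℕ) k ≤ 1 := by
  classical
  rw [Set.indicator_apply]; split_ifs <;> simp

namespace IsJumpFraction

variable {J T : ℕ → ℕ} {b : Set ℕ} {x : ℝ} {A Q : ℕ → ℕ} {P : ℕ → ℤ}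

/-- Continuants determine where jumps occur, hence the part of each quotient not coming from `b`;
the remainder is the binary digit. -/
theorem index_unique {b' : Set ℕ} {A' Q' : ℕ → ℕ} {P' : ℕ → ℤ} (h : IsJumpFraction J T b x A Q P)
    (h' : IsJumpFraction J T b' x A' Q' P') : b = b' := by
  have hA : ∀ k, A k = A' k := fun k => by
    exact_mod_cast (h.partialQuotient_eq k).symm.trans (h'.partialQuotient_eq k)
  have hQ : ∀ k, Q k = Q' k := fun k => by
    exact_mod_cast (h.continuant_eq k).symm.trans (h'.continuant_eq k)
  have hind : ∀ k, b.indicator (1 : ℕ → ℕ) k = b'.indicator 1 k := by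
    intro k
    cases k with
    | zero =>
      have h1 := h.quotient_zero
      have h2 := h'.quotient_zero
      have h3 := hA 0
      omega
    | succ k =>
      have h3 := hA (k + 1)
      by_cases hj : ∃ m, Q k < T m ∧ T m ≤ Q (k + 1)
      · have h1 := h.quotient_of_jump k hj
        rw [hQ, hQ] at hj
        have h2 := h'.quotient_of_jump k hj
        rw [hQ] at h1
        omega
      · have h1 := h.quotient_of_not_jump k hj
        rw [hQ, hQ] at hj
        have h2 := h'.quotient_of_not_jump k hj
        omega
  ext k
  classical
  have := hind k
  rw [Set.indicator_apply, Set.indicator_apply] at this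
  by_cases hb : k ∈ b <;> by_cases hb' : k ∈ b' <;> simp_all

theorem den_succ_le_mul (h : IsJumpFraction J T b x A Q P) (hJ : ∀ v, 1 ≤ v → 1 ≤ J v) (k : ℕ) :
    Q (k + 1) ≤ (J (Q k) + 2) * Q k := by
  refine (h.den_succ_le k).trans (Nat.mul_le_mul_right _ ?_)
  have h1 := hJ (Q k) (h.den_pos k)
  have h2 := indicator_one_le_one b k
  cases k with
  | zero => rw [h.quotient_zero]; omega
  | succ k =>
    by_cases hj : ∃ m, Q k < T m ∧ T m ≤ Q (k + 1)
    · rw [h.quotient_of_jump k hj]; omega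
    · rw [h.quotient_of_not_jump k hj]; omega

theorem den_one_le (h : IsJumpFraction J T b x A Q P) : Q 1 ≤ 3 * Q 0 := by
  have := indicator_one_le_one b 0
  rw [h.den_one, h.quotient_zero, h.den_zero]; omega

theorem den_succ_le_three_mul (h : IsJumpFraction J T b x A Q P) {k : ℕ}
    (hk : ¬ ∃ m, Q k < T m ∧ T m ≤ Q (k + 1)) : Q (k + 2) ≤ 3 * Q (k + 1) := by
  refine (h.den_succ_le (k + 1)).trans (Nat.mul_le_mul_right _ ?_)
  have := indicator_one_le_one b (k + 1)
  rw [h.quotient_of_not_jump k hk]; omega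

/-- The continuant that first reaches `T m` is at most `3 T m`: an ordinary step at most triples,
and a jump at an earlier threshold lands, by induction, below `T m`. The jump then multiplies by at
most `J + 2`, so it cannot reach the next threshold. -/
theorem den_le_of_jump (h : IsJumpFraction J T b x A Q P) (hJ : ∀ v, 1 ≤ v → 1 ≤ J v)
    (hJm : Monotone J) (hT : StrictMono T)
    (hTg : ∀ m, (J (3 * T m) + 2) * (3 * T m) < T (m + 1)) (k : ℕ) :
    ∀ m, Q k < T m → T m ≤ Q (k + 1) → Q (k + 2) ≤ (J (3 * T m) + 2) * (3 * T m) := by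
  induction k with
  | zero =>
    intro m h1 _
    have h3 : Q 1 ≤ 3 * T m := h.den_one_le.trans (by omega)
    exact (h.den_succ_le_mul hJ 1).trans
      (Nat.mul_le_mul (Nat.add_le_add_right (hJm h3) 2) h3)
  | succ k ih =>
    intro m h1 h2
    have h3 : Q (k + 2) ≤ 3 * T m := by
      by_cases hj : ∃ m, Q k < T m ∧ T m ≤ Q (k + 1)
      · obtain ⟨i, hi1, hi2⟩ := hj
        have him : i + 1 ≤ m := hT.lt_iff_lt.1 (hi2.trans_lt h1)
        have h4 := ih i hi1 hi2
        have h5 := hTg i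
        have h6 := hT.monotone him
        omega
      · have := h.den_succ_le_three_mul hj
        omega
    exact (h.den_succ_le_mul hJ (k + 2)).trans
      (Nat.mul_le_mul (Nat.add_le_add_right (hJm h3) 2) h3)

theorem exists_den_between (h : IsJumpFraction J T b x A Q P) (hJ : ∀ v, 1 ≤ v → 1 ≤ J v)
    (hJm : Monotone J) (hT : StrictMono T)
    (hTg : ∀ m, (J (3 * T m) + 2) * (3 * T m) < T (m + 1)) {m : ℕ} {X : ℝ} (hX : 1 ≤ X)
    (hX1 : (((J (3 * T m) + 2) * (3 * T m) : ℕ) : ℝ) ≤ X) (hX2 : X < T (m + 1)) :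
    ∃ j, (Q j : ℝ) ≤ X ∧ X ≤ 3 * (Q j : ℝ) ^ 2 := by
  obtain ⟨j, hj1, hj2⟩ := h.exists_den_le_lt hX
  refine ⟨j, hj1, ?_⟩
  have hQ1 : (1 : ℝ) ≤ Q j := by exact_mod_cast h.den_pos j
  have h3 : Q (j + 1) ≤ 3 * Q j := by
    cases j with
    | zero => exact h.den_one_le
    | succ i =>
      refine h.den_succ_le_three_mul ?_
      -- A jump in this step would belong to some `T l` with `l ≤ m`, and its landing point would
      -- already be at most `X`.
      rintro ⟨l, hl1, hl2⟩
      have hlm : l ≤ m := by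
        have h4 : (T l : ℝ) < T (m + 1) :=
          lt_of_le_of_lt (by exact_mod_cast hl2) (hj1.trans_lt hX2)
        have h5 : T l < T (m + 1) := by exact_mod_cast h4
        exact Nat.lt_succ_iff.1 (hT.lt_iff_lt.1 h5)
      have h6 := h.den_le_of_jump hJ hJm hT hTg i l hl1 hl2
      have h7 : 3 * T l ≤ 3 * T m := Nat.mul_le_mul_left 3 (hT.monotone hlm)
      have h8 : Q (i + 2) ≤ (J (3 * T m) + 2) * (3 * T m) :=
        h6.trans (Nat.mul_le_mul (Nat.add_le_add_right (hJm h7) 2) h7)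
      have h9 : (Q (i + 2) : ℝ) ≤ X := le_trans (by exact_mod_cast h8) hX1
      exact absurd hj2 (not_lt.2 h9)
  have h4 : (Q (j + 1) : ℝ) ≤ 3 * Q j := by exact_mod_cast h3
  nlinarith

theorem exists_abs_sub_lt (h : IsJumpFraction J T b x A Q P) (hJ : ∀ v, 1 ≤ v → 1 ≤ J v) {m : ℕ}
    (hm : 2 ≤ T m) :
    ∃ q : ℕ, T m ≤ q ∧ 1 ≤ q ∧ ∃ p : ℤ, |(q : ℝ) * x - p| < 1 / ((J q * q : ℕ) : ℝ) := by
  have hX : (1 : ℝ) ≤ (T m : ℝ) - 1 := by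
    have : (2 : ℝ) ≤ T m := by exact_mod_cast hm
    linarith
  obtain ⟨k, hk1, hk2⟩ := h.exists_den_le_lt hX
  have hk1' : Q k < T m := by
    have : (Q k : ℝ) < T m := by linarith
    exact_mod_cast this
  have hk2' : T m ≤ Q (k + 1) := by
    have : (T m : ℝ) < Q (k + 1) + 1 := by linarith
    exact Nat.lt_succ_iff.1 (by exact_mod_cast this)
  refine ⟨Q (k + 1), hk2', h.den_pos _, P (k + 1), ?_⟩
  refine (h.abs_sub_le (k + 1)).trans_lt (one_div_lt_one_div_of_lt ?_ ?_)
  · exact_mod_cast Nat.mul_pos (hJ _ (h.den_pos (k + 1))) (h.den_pos (k + 1))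
  · have h3 := h.den_add_two k
    rw [h.quotient_of_jump k ⟨m, hk1', hk2'⟩, add_mul] at h3
    have h4 := h.den_pos k
    have h5 : J (Q (k + 1)) * Q (k + 1) < Q (k + 1 + 1) := by
      have e : k + 1 + 1 = k + 2 := rfl
      rw [e, h3]; omega
    exact_mod_cast h5

end IsJumpFraction

/-- Each `T (m + 1)` is taken so large that the scales between `g (T m)` and `T (m + 1)` already
carry weight at least `1`; infinitely many such windows keep the series divergent. -/
theorem exists_sparse_thresholds {f : ℕ → ℝ} (hf : ∀ k, 0 ≤ f k) {K : Set ℕ}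
    (hdiv : ¬ Summable (K.indicator f)) {ε : ℝ} (hε : 0 < ε) (g : ℕ → ℕ) (hg : ∀ t, t ≤ g t) :
    ∃ T : ℕ → ℕ, StrictMono T ∧ 2 ≤ T 0 ∧ (∀ m, g (T m) < T (m + 1)) ∧
      ¬ Summable ((K ∩ {k | ∃ m, (g (T m) : ℝ) ≤ ε * 2 ^ k ∧ ε * 2 ^ k < T (m + 1)}).indicator
        f) := by
  have hstep : ∀ t : ℕ, ∃ (t' : ℕ) (F : Finset ℕ), g t < t' ∧ 1 ≤ ∑ k ∈ F, f k ∧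
      ∀ k ∈ F, k ∈ K ∧ (g t : ℝ) ≤ ε * 2 ^ k ∧ ε * 2 ^ k < t' := by
    intro t
    obtain ⟨k₀, hk₀⟩ := pow_unbounded_of_one_lt (g t / ε) one_lt_two
    rw [div_lt_iff₀ hε] at hk₀
    obtain ⟨F, hF, hsum⟩ := exists_finset_sum_ge hf hdiv k₀ 1
    obtain ⟨t', ht'⟩ := exists_nat_gt (g t + ∑ k ∈ F, ε * 2 ^ k)
    have hpos : ∀ k ∈ F, 0 ≤ ε * (2 : ℝ) ^ k := fun k _ => by positivity
    refine ⟨t', F, ?_, hsum, fun k hk => ⟨(hF k hk).1, ?_, ?_⟩⟩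
    · have : (g t : ℝ) < t' := by linarith [Finset.sum_nonneg hpos]
      exact_mod_cast this
    · have : (2 : ℝ) ^ k₀ ≤ 2 ^ k := pow_le_pow_right₀ one_le_two (hF k hk).2
      nlinarith
    · have := Finset.single_le_sum hpos hk
      have : (0 : ℝ) ≤ g t := Nat.cast_nonneg _
      linarith
  choose next F hnext hsum hF using hstep
  set T : ℕ → ℕ := fun m => next^[m] 2 with hT
  have hTs : ∀ m, T (m + 1) = next (T m) := fun m => Function.iterate_succ_apply' next m 2
  have hTg : ∀ m, g (T m) < T (m + 1) := fun m => by rw [hTs]; exact hnext _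
  have hmono : StrictMono T := strictMono_nat_of_lt_succ fun m => (hg _).trans_lt (hTg m)
  refine ⟨T, hmono, le_rfl, hTg, fun hs => ?_⟩
  obtain ⟨s, hs⟩ := summable_iff_vanishing_norm.1 hs 1 one_pos
  obtain ⟨B, hB⟩ := exists_nat_gt (∑ k ∈ s, ε * 2 ^ k)
  have hdisj : Disjoint (F (T B)) s := by
    refine Finset.disjoint_left.2 fun k hk hks => ?_
    have h1 := (hF (T B) k hk).2.1
    have h2 := Finset.single_le_sum (f := fun k => ε * (2 : ℝ) ^ k) (fun k _ => by positivity) hks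
    have h3 : (B : ℝ) ≤ g (T B) := by exact_mod_cast hmono.le_apply.trans (hg (T B))
    linarith
  have h1 := hs (F (T B)) hdisj
  have h2 : ∑ k ∈ F (T B), (K ∩ {k | ∃ m, (g (T m) : ℝ) ≤ ε * 2 ^ k ∧
      ε * 2 ^ k < T (m + 1)}).indicator f k = ∑ k ∈ F (T B), f k := by
    refine Finset.sum_congr rfl fun k hk => Set.indicator_of_mem ?_ _
    obtain ⟨h3, h4, h5⟩ := hF (T B) k hk
    exact ⟨h3, B, h4, by rw [hTs]; exact h5⟩
  rw [h2, Real.norm_eq_abs] at h1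
  linarith [hsum (T B), le_abs_self (∑ k ∈ F (T B), f k)]

/-- Thresholds so sparse that the fiber over every number with jumps there is full. -/
theorem exists_thresholds_fullFiber {n : ℕ} (hn : 2 ≤ n) {ψ : ℕ → ℝ}
    (hψ : IsApproximatingFunction ψ) (hdiv : ¬ Summable fun q : ℕ => ψ q ^ (n + 1)) {J : ℕ → ℕ}
    (hJ : ∀ v, 1 ≤ v → 1 ≤ J v) (hJm : Monotone J) :
    ∃ T : ℕ → ℕ, StrictMono T ∧ 2 ≤ T 0 ∧
      ∀ b x A Q P, IsJumpFraction J T b x A Q P → FullFiber n ψ x := by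
  obtain ⟨φ, hφ0, hanti, hφ1, hφψ, hdiv'⟩ := exists_truncation hn hψ hdiv
  set ε : ℝ := 1 / (120 * 10 ^ n) with hε
  have hε0 : 0 < ε := by positivity
  obtain ⟨T, hT, hT0, hTg, hsum⟩ := exists_sparse_thresholds
    (fun k => mul_nonneg (by positivity) (pow_nonneg (hφ0 k).le _)) hdiv' hε0
    -- The landing bound after a jump: scales between it and the next threshold see continuants
    -- growing by a factor of at most `3`.
    (fun t => (J (3 * t) + 2) * (3 * t))
    (fun t => by nlinarith [Nat.zero_le (J (3 * t) * t)])
  refine ⟨T, hT, hT0, fun b x A Q P h => ?_⟩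
  refine fullFiber_of_sq_ge (by omega) hε0 (mul_one_div_cancel (by positivity)).le hψ hφ0 hanti hφ1
    hφψ hsum (fun k hk => hk.1) (C := 3) (by norm_num) fun k hk => ?_
  obtain ⟨m, hm1, hm2⟩ := hk.2
  have hX : 1 ≤ ε * 2 ^ k := by
    refine le_trans ?_ hm1
    have h1 : 1 ≤ 3 * T m := by have := hT.monotone (Nat.zero_le m); omega
    exact_mod_cast Nat.mul_pos (by omega) h1
  obtain ⟨j, hj1, hj2⟩ := h.exists_den_between hJ hJm hT hTg hX hm1 hm2
  exact ⟨P j, Q j, h.den_pos j, h.coprime j, h.abs_sub_le_self j, hj1, hj2⟩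

/-- If `Q k ≤ 2q < Q (k+1)`, separation of multiples gives `‖qx‖ ≥ 1/(2 Q (k+1))`, and the bound on
`J` gives `Q (k+1) ≤ 4 (2q)^σ`. The resulting constant `8 · 2^σ` is beaten by `q^(τ-σ)`. -/
theorem IsJumpFraction.notMem_approximableOne {J T : ℕ → ℕ} {b : Set ℕ} {x : ℝ} {A Q : ℕ → ℕ}
    {P : ℕ → ℤ} (h : IsJumpFraction J T b x A Q P) {σ τ : ℝ} (hσ : 1 ≤ σ) (hστ : σ < τ)
    (hJ : ∀ v, 1 ≤ v → 1 ≤ J v) (hJσ : ∀ v : ℕ, 1 ≤ v → (J v : ℝ) ≤ (v : ℝ) ^ (σ - 1) + 1) :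
    x ∉ approximableOne τ := by
  have htend := tendsto_rpow_atTop (sub_pos.2 hστ)
  obtain ⟨m, hm⟩ := (htend.comp tendsto_natCast_atTop_atTop).eventually_ge_atTop
    (8 * (2 : ℝ) ^ σ) |> Filter.eventually_atTop.1
  refine _root_.notMem_approximableOne (by linarith) (m := m) fun q hq hq1 p => ?_
  have hq0 : (1 : ℝ) ≤ q := by exact_mod_cast hq1
  obtain ⟨k, hk1, hk2⟩ := h.exists_den_le_lt (X := 2 * q) (by linarith)
  have hk2' : 2 * q ≤ Q (k + 1) := by
    have : ((2 * q : ℕ) : ℝ) ≤ Q (k + 1) := by push_cast; exact hk2.le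
    exact_mod_cast this
  refine le_trans ?_ (one_div_two_mul_le_abs_sub (h.coprime (k + 1)) (h.abs_sub_le_self (k + 1))
    hq1 hk2' p)
  have hQ1 : (1 : ℝ) ≤ Q k := by exact_mod_cast h.den_pos k
  have hQσ : (Q k : ℝ) ≤ (Q k : ℝ) ^ σ := by
    calc (Q k : ℝ) = (Q k : ℝ) ^ (1 : ℝ) := (Real.rpow_one _).symm
      _ ≤ _ := Real.rpow_le_rpow_of_exponent_le hQ1 hσ
  have h1 : (Q (k + 1) : ℝ) ≤ 4 * (2 * (q : ℝ)) ^ σ := by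
    calc (Q (k + 1) : ℝ) ≤ (J (Q k) + 2) * Q k := by exact_mod_cast h.den_succ_le_mul hJ k
      _ ≤ ((Q k : ℝ) ^ (σ - 1) + 1 + 2) * Q k := by gcongr; exact hJσ _ (h.den_pos k)
      _ = (Q k : ℝ) ^ σ + 3 * Q k := by
        rw [show (Q k : ℝ) ^ σ = (Q k : ℝ) ^ (σ - 1) * Q k by
          rw [← Real.rpow_add_one (by linarith)]; ring_nf]
        ring
      _ ≤ 4 * (Q k : ℝ) ^ σ := by linarith
      _ ≤ 4 * (2 * (q : ℝ)) ^ σ := by gcongr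
  have h2 : 8 * (2 : ℝ) ^ σ ≤ (q : ℝ) ^ (τ - σ) := hm q hq
  have hQ' := h.den_cast_pos (k + 1)
  rw [Real.rpow_neg (by linarith), ← one_div]
  refine one_div_le_one_div_of_le (by positivity) ?_
  calc 2 * (Q (k + 1) : ℝ) ≤ 2 * (4 * (2 * (q : ℝ)) ^ σ) := by gcongr
    _ = 8 * 2 ^ σ * (q : ℝ) ^ σ := by
      rw [Real.mul_rpow (by norm_num) (by linarith)]; ring
    _ ≤ (q : ℝ) ^ (τ - σ) * (q : ℝ) ^ σ := by gcongr
    _ = (q : ℝ) ^ τ := by rw [← Real.rpow_add (by linarith)]; ring_nf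

theorem IsJumpFraction.mem_approximableOne {J T : ℕ → ℕ} {b : Set ℕ} {x : ℝ} {A Q : ℕ → ℕ}
    {P : ℕ → ℤ} (h : IsJumpFraction J T b x A Q P) (hT : StrictMono T) (hT0 : 2 ≤ T 0)
    (hJ : ∀ v, 1 ≤ v → 1 ≤ J v) {σ : ℝ} {v₀ : ℕ}
    (hJσ : ∀ v : ℕ, v₀ ≤ v → 1 ≤ v → (v : ℝ) ^ σ ≤ ((J v * v : ℕ) : ℝ)) :
    x ∈ approximableOne σ := by
  refine _root_.mem_approximableOne fun m => ?_
  have hTm : 2 ≤ T (max m v₀) := hT0.trans (hT.monotone (Nat.zero_le _))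
  obtain ⟨q, hq, hq1, p, hp⟩ := h.exists_abs_sub_lt hJ hTm
  have hle : max m v₀ ≤ q := hT.le_apply.trans hq
  refine ⟨q, (le_max_left _ _).trans hle, hq1, p, hp.trans_le ?_⟩
  have hq0 : (0 : ℝ) < q := by exact_mod_cast hq1
  rw [Real.rpow_neg hq0.le, ← one_div]
  exact one_div_le_one_div_of_le (by positivity) (hJσ q ((le_max_right _ _).trans hle) hq1)

/-- A jump quotient `J(Q)` yields `‖Qx‖ < 1/(J(Q) Q)`, so `J(v) = ⌈v^(σ-1)⌉` realises the exponent
`σ` exactly. For `σ = ∞` the choice `(v+1)^v` outgrows every power. -/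
theorem exists_jump_function {σ : ℝ≥0∞} (hσ : 1 ≤ σ) :
    ∃ J : ℕ → ℕ, Monotone J ∧ (∀ v, 1 ≤ v → 1 ≤ J v) ∧
      ∀ (T : ℕ → ℕ) (b : Set ℕ) (x : ℝ) (A Q : ℕ → ℕ) (P : ℕ → ℤ), StrictMono T → 2 ≤ T 0 →
        IsJumpFraction J T b x A Q P → diophantineType x = σ := by
  induction σ using ENNReal.recTopCoe with
  | top =>
    have hJ : ∀ v : ℕ, 1 ≤ v → 1 ≤ (v + 1) ^ v := fun v _ => Nat.one_le_pow _ _ (by omega)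
    refine ⟨fun v => (v + 1) ^ v, fun u v huv => ?_, hJ, fun T b x A Q P hT hT0 h => ?_⟩
    · exact (Nat.pow_le_pow_left (by omega) u).trans (Nat.pow_le_pow_right (by omega) huv)
    · refine ENNReal.eq_top_of_forall_nnreal_le fun r => ?_
      have hmem : x ∈ approximableOne ((r : ℝ) + 1) := by
        refine h.mem_approximableOne hT hT0 hJ (v₀ := ⌈(r : ℝ) + 1⌉₊) fun v hv hv1 => ?_
        have hv0 : (1 : ℝ) ≤ v := by exact_mod_cast hv1
        calc (v : ℝ) ^ ((r : ℝ) + 1) ≤ (v : ℝ) ^ (v : ℝ) :=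
              Real.rpow_le_rpow_of_exponent_le hv0 (Nat.ceil_le.1 hv)
          _ = (v : ℝ) ^ v := Real.rpow_natCast _ _
          _ ≤ (((v + 1) ^ v * v : ℕ) : ℝ) := by
            exact_mod_cast (Nat.pow_le_pow_left (Nat.le_succ v) v).trans
              (Nat.le_mul_of_pos_right _ hv1)
      refine le_trans ?_ (le_iSup₂ (f := fun τ (_ : τ ∈ {τ : ℝ | 0 < τ ∧ x ∈ approximableOne τ}) =>
        ENNReal.ofReal τ) ((r : ℝ) + 1) ⟨by positivity, hmem⟩)
      rw [← ENNReal.ofReal_coe_nnreal]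
      exact ENNReal.ofReal_le_ofReal (by linarith)
  | coe s =>
    have hs : (1 : ℝ) ≤ s := by exact_mod_cast hσ
    have hJ : ∀ v : ℕ, 1 ≤ v → 1 ≤ ⌈(v : ℝ) ^ ((s : ℝ) - 1)⌉₊ := fun v hv => by
      have : (0 : ℝ) < v := by exact_mod_cast hv
      exact Nat.ceil_pos.2 (by positivity)
    refine ⟨fun v => ⌈(v : ℝ) ^ ((s : ℝ) - 1)⌉₊, fun u v huv => Nat.ceil_le_ceil ?_, hJ,
      fun T b x A Q P hT hT0 h => le_antisymm (iSup₂_le fun τ hτ => ?_) ?_⟩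
    · exact Real.rpow_le_rpow (Nat.cast_nonneg _) (by exact_mod_cast huv) (by linarith)
    · rw [← ENNReal.ofReal_coe_nnreal]
      refine ENNReal.ofReal_le_ofReal (not_lt.1 fun hlt => ?_)
      refine h.notMem_approximableOne hs hlt hJ (fun v _ => ?_) hτ.2
      exact (Nat.ceil_lt_add_one (by positivity)).le
    · have hmem : x ∈ approximableOne (s : ℝ) := by
        refine h.mem_approximableOne hT hT0 hJ (v₀ := 0) fun v _ hv1 => ?_
        have hv0 : (0 : ℝ) < v := by exact_mod_cast hv1
        calc (v : ℝ) ^ (s : ℝ) = (v : ℝ) ^ ((s : ℝ) - 1) * v := by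
              rw [← Real.rpow_add_one hv0.ne']; ring_nf
          _ ≤ ⌈(v : ℝ) ^ ((s : ℝ) - 1)⌉₊ * v := by gcongr; exact Nat.le_ceil _
          _ = _ := by push_cast; rfl
      refine le_trans ?_ (le_iSup₂ (f := fun τ (_ : τ ∈ {τ : ℝ | 0 < τ ∧ x ∈ approximableOne τ}) =>
        ENNReal.ofReal τ) (s : ℝ) ⟨by linarith, hmem⟩)
      rw [ENNReal.ofReal_coe_nnreal]

theorem not_countable_diophantineType_fullFiber {n : ℕ} (hn : 2 ≤ n) {ψ : ℕ → ℝ}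
    (hψ : IsApproximatingFunction ψ) (hdiv : ¬ Summable fun q : ℕ => ψ q ^ (n + 1)) {σ : ℝ≥0∞}
    (hσ : 1 ≤ σ) : ¬ {x : ℝ | diophantineType x = σ ∧ FullFiber n ψ x}.Countable := by
  intro hcount
  obtain ⟨J, hJm, hJ, htype⟩ := exists_jump_function hσ
  obtain ⟨T, hT, hT0, hfull⟩ := exists_thresholds_fullFiber hn hψ hdiv hJ hJm
  -- One number for each set of naturals, all with the same thresholds: an injection of the power
  -- set of `ℕ`, so Cantor's theorem excludes countability.
  choose x A Q P h using fun b => exists_isJumpFraction hJ T b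
  have hinj : Function.Injective x := fun b b' hbb => by
    have h' := h b'
    rw [← hbb] at h'
    exact (h b).index_unique h'
  have : Countable {x : ℝ | diophantineType x = σ ∧ FullFiber n ψ x} := hcount.to_subtype
  have : Countable (Set ℕ) := Function.Injective.countable
    (f := fun b => (⟨x b, htype T b _ _ _ _ hT hT0 (h b), hfull _ _ _ _ _ (h b)⟩ :
      {x : ℝ | diophantineType x = σ ∧ FullFiber n ψ x}))
    fun b b' hbb => hinj (congrArg Subtype.val hbb)
  obtain ⟨f, hf⟩ := exists_surjective_nat (Set ℕ)
  exact Function.cantor_surjective f hf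

/-- Here `d = n + 1`, so `n ≥ 1` means `d ≥ 2` and `n ≥ 2` means `d ≥ 3`. -/
theorem theorem3 (n : ℕ) (hn : 1 ≤ n) (ψ : ℕ → ℝ) (hψ : IsApproximatingFunction ψ)
    (hdiv : ¬ Summable (fun q : ℕ => ψ q ^ (n + 1))) :
    (∀ x : ℚ, FullFiber n ψ (x : ℝ)) ∧
    (2 ≤ n → ∀ x : ℝ, PositiveDensityProperty x → FullFiber n ψ x) ∧
    (∀ x : ℝ, x ∉ approximableOne Real.goldenRatio → PositiveDensityProperty x) ∧
    (∀ x : ℝ, x ∉ approximableOne 2 → ContinuantsDouble x → PositiveDensityProperty x) ∧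
    (∃ x : ℝ, PositiveDensityProperty x ∧ x ∈ approximableOne Real.goldenRatio ∧
      ¬ (x ∉ approximableOne 2 ∧ ContinuantsDouble x)) ∧
    (2 ≤ n → ∀ σ : ℝ≥0∞, 1 ≤ σ →
      ¬ {x : ℝ | diophantineType x = σ ∧ FullFiber n ψ x}.Countable) := by
  refine ⟨fullFiber_ratCast hn hψ hdiv, fun hn2 x hx => ?_,
    fun x => positiveDensityProperty_of_notMem_goldenRatio,
    fun x => positiveDensityProperty_of_continuantsDouble, ?_,
    fun hn2 σ hσ => not_countable_diophantineType_fullFiber hn2 hψ hdiv hσ⟩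
  · obtain ⟨A, Q, P, h⟩ := exists_hasContinuedFraction hx.1
    obtain ⟨C, k₀, hC⟩ := h.exists_den_succ_le_of_positiveDensityProperty hx
    exact h.fullFiber hC hn2 hψ hdiv
  -- Membership at exponent `2` excludes both classes at once, because the golden ratio is below
  -- `2`.
  · obtain ⟨x, hx, hx2⟩ := exists_positiveDensityProperty_mem_approximableOne_two
    exact ⟨x, hx, approximableOne_anti Real.goldenRatio_lt_two.le hx2, fun h => h.1 hx2⟩
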